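/- Let $N\ge 1$, $0<\alpha<1$ and $1<p<\frac{N}{2\alpha}$. There is a constant $C=C(N,\alpha,p)>0$ with the following property. Let $D\subset\mathbb{R}^N$ be a bounded domain (nonempty, open, connected), $\mathcal C_D=D\times(0,\infty)$ with points $(x,y)$, $\partial_L\mathcal C_D=\partial D\times(0,\infty)$, and let $f\ge 0$ be Hölder continuous on $D$ with some exponent $\beta\in(0,1)$, that is, $|f(x)-f(x')|\le K|x-x'|^\beta$ for all $x,x'\in D$ and some $K$. Let $w$ be the weak solution of $$\operatorname{div}(y^{1-2\alpha}\nabla w)=0\ \text{ in }\mathcal C_D,\qquad w=0\ \text{ on }\partial_L\mathcal C_D,\qquad y^{1-2\alpha}\frac{\partial w}{\partial\nu}=f\ \text{ on }D\times\{0\},$$ where $\nu$ is the outward normal. Explicitly, $w$ belongs to $H^1_{0,L}(\mathcal C_D)$, the space of $w\in L^2(\mathcal C_D)$ having a weak gradient with $\int_{\mathcal C_D}y^{1-2\alpha}|\nabla w|^2\,dx\,dy<\infty$ and vanishing on $\partial_L\mathcal C_D$ in the sense that $w$ is a limit, in the norm $\big(\int_{\mathcal C_D}w^2+\int_{\mathcal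 C_D}y^{1-2\alpha}|\nabla w|^2\big)^{1/2}$, of restrictions to $\mathcal C_D$ of functions in $C_c^\infty(D\times\mathbb{R})$, and $$\int_{\mathcal C_D}y^{1-2\alpha}\,\nabla w\cdot\nabla\varphi\,dx\,dy=\int_D f(x)\,\varphi(x,0)\,dx\qquad\text{for all }\varphi\in C_c^\infty(D\times\mathbb{R}).$$ Then $w$ has a trace $w(\cdot,0)\in L^2(D)$, in the sense that $\frac1\varepsilon\int_0^\varepsilon\|w(\cdot,y)-w(\cdot,0)\|_{L^2(D)}^2\,dy\to0$ as $\varepsilon\to0^+$, and $$\|w(\cdot,0)\|_{L^{\frac{Np}{N-2\alpha p}}(D)}\le C\,\|f\|_{L^p(D)}.$$ -/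

import Mathlib

open MeasureTheory Set Filter Topology
open scoped NNReal ENNReal ContDiff

noncomputable section

namespace ExtensionProblem

/-- The cylinder `D × (0, ∞)` in `ℝᴺ × ℝ`; points are written `X = (x, y)`. -/
def cylinder {N : ℕ} (D : Set (EuclideanSpace ℝ (Fin N))) :
    Set (EuclideanSpace ℝ (Fin N) × ℝ) :=
  D ×ˢ Ioi (0 : ℝ)

/-- The measure `y ^ (1 - 2α) dx dy` on the cylinder over `D`. -/
def weightedMeasure {N : ℕ} (α : ℝ) (D : Set (EuclideanSpace ℝ (Fin N))) :
    Measure (EuclideanSpace ℝ (Fin N) × ℝ) :=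
  (volume.restrict (cylinder D)).withDensity fun X => ENNReal.ofReal (X.2 ^ (1 - 2 * α))

/-- The classical gradient `∇ₓ φ` in the horizontal variable. -/
def gradX {N : ℕ} (φ : EuclideanSpace ℝ (Fin N) × ℝ → ℝ)
    (X : EuclideanSpace ℝ (Fin N) × ℝ) : EuclideanSpace ℝ (Fin N) :=
  gradient (fun x => φ (x, X.2)) X.1

/-- The classical derivative `∂φ/∂y` in the vertical variable. -/
def derivY {N : ℕ} (φ : EuclideanSpace ℝ (Fin N) × ℝ → ℝ)
    (X : EuclideanSpace ℝ (Fin N) × ℝ) : ℝ :=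
  deriv (fun y => φ (X.1, y)) X.2

/-- `φ` is a smooth function on `ℝᴺ × ℝ` with compact support contained in the set `U`. -/
structure IsTestFunction {N : ℕ} (U : Set (EuclideanSpace ℝ (Fin N) × ℝ))
    (φ : EuclideanSpace ℝ (Fin N) × ℝ → ℝ) : Prop where
  smooth : ContDiff ℝ ∞ φ
  compact_support : HasCompactSupport φ
  support_subset : tsupport φ ⊆ U

/-- `(Gx, Gy)` is the weak (distributional) gradient of `w` in the open cylinder over `D`. -/
structure HasWeakGradient {N : ℕ} (D : Set (EuclideanSpace ℝ (Fin N)))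
    (w : EuclideanSpace ℝ (Fin N) × ℝ → ℝ)
    (Gx : EuclideanSpace ℝ (Fin N) × ℝ → EuclideanSpace ℝ (Fin N))
    (Gy : EuclideanSpace ℝ (Fin N) × ℝ → ℝ) : Prop where
  horizontal : ∀ ψ, IsTestFunction (cylinder D) ψ →
    ∫ X in cylinder D, w X • gradX ψ X = - ∫ X in cylinder D, ψ X • Gx X
  vertical : ∀ ψ, IsTestFunction (cylinder D) ψ →
    ∫ X in cylinder D, w X * derivY ψ X = - ∫ X in cylinder D, ψ X * Gy X

/-- `w` belongs to the energy space `H¹_{0,L}` of the cylinder over `D` and has weak gradient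
`(Gx, Gy)`: `w` is square integrable, `∫ y ^ (1 - 2α) |∇w|²` is finite, and `w` vanishes on the
lateral boundary. Since `D` is an arbitrary bounded domain, the last condition has its usual `H¹₀`
meaning: `w` is a limit, in the norm of the space, of smooth functions whose support is a compact
subset of `D × ℝ`, so that they vanish near the lateral boundary but not necessarily
at `D × {0}`. -/
structure MemEnergySpace {N : ℕ} (α : ℝ) (D : Set (EuclideanSpace ℝ (Fin N)))
    (w : EuclideanSpace ℝ (Fin N) × ℝ → ℝ)
    (Gx : EuclideanSpace ℝ (Fin N) × ℝ → EuclideanSpace ℝ (Fin N))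
    (Gy : EuclideanSpace ℝ (Fin N) × ℝ → ℝ) : Prop where
  memLp : MemLp w 2 (volume.restrict (cylinder D))
  memLp_gradX : MemLp Gx 2 (weightedMeasure α D)
  memLp_derivY : MemLp Gy 2 (weightedMeasure α D)
  weakGradient : HasWeakGradient D w Gx Gy
  lateral_zero : ∃ φ : ℕ → EuclideanSpace ℝ (Fin N) × ℝ → ℝ,
    (∀ n, IsTestFunction (D ×ˢ (univ : Set ℝ)) (φ n)) ∧
    Tendsto (fun n => eLpNorm (fun X => φ n X - w X) 2 (volume.restrict (cylinder D)))
      atTop (𝓝 0) ∧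
    Tendsto (fun n => eLpNorm (fun X => gradX (φ n) X - Gx X) 2 (weightedMeasure α D))
      atTop (𝓝 0) ∧
    Tendsto (fun n => eLpNorm (fun X => derivY (φ n) X - Gy X) 2 (weightedMeasure α D))
      atTop (𝓝 0)

/-- `w` is a (weak, finite energy) solution of
`div (y ^ (1 - 2α) ∇w) = 0` in `D × (0, ∞)`, `w = 0` on `∂D × (0, ∞)`,
`y ^ (1 - 2α) ∂w/∂ν = f` on `D × {0}`, with `ν` the outward normal. -/
def IsWeakSolution {N : ℕ} (α : ℝ) (D : Set (EuclideanSpace ℝ (Fin N)))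
    (f : EuclideanSpace ℝ (Fin N) → ℝ) (w : EuclideanSpace ℝ (Fin N) × ℝ → ℝ) : Prop :=
  ∃ (Gx : EuclideanSpace ℝ (Fin N) × ℝ → EuclideanSpace ℝ (Fin N))
    (Gy : EuclideanSpace ℝ (Fin N) × ℝ → ℝ),
    MemEnergySpace α D w Gx Gy ∧
    ∀ φ, IsTestFunction (D ×ˢ (univ : Set ℝ)) φ →
      ∫ X, (inner ℝ (Gx X) (gradX φ X) + Gy X * derivY φ X) ∂(weightedMeasure α D)
        = ∫ x in D, f x * φ (x, 0)

/-- `u` is the trace `w(·, 0)`: the functions `w(·, y)` tend to `u` in `L²(D)` as `y → 0⁺`, in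
the mean over `0 < y < ε` (so that the notion does not depend on the representative of `w`). -/
structure HasTrace {N : ℕ} (D : Set (EuclideanSpace ℝ (Fin N)))
    (w : EuclideanSpace ℝ (Fin N) × ℝ → ℝ) (u : EuclideanSpace ℝ (Fin N) → ℝ) : Prop where
  memLp : MemLp u 2 (volume.restrict D)
  tendsto : Tendsto
    (fun ε : ℝ => ENNReal.ofReal ε⁻¹ *
      ∫⁻ X in D ×ˢ Ioo (0 : ℝ) ε, ‖w X - u X.1‖ₑ ^ 2)
    (𝓝[>] (0 : ℝ)) (𝓝 0)

end ExtensionProblem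

end

/-!
The estimate is proved by testing the equation with truncations of the solution, so that it reduces
to a trace inequality for indicators of sets; no representation of the solution by a potential is
needed. Write `u` for the trace of `w`, `κ = N / (N - 2α)` and `q = N p / (N - 2αp)`.

*Trace inequality* (`exists_lintegral_trace_le`). For a test function `φ` and a set `A ⊆ ℝᴺ`,
`∫_A |φ(x, 0)| dx ≤ C (∫ y ^ (1 - 2α) |∇φ|²) ^ (1 / 2) |A| ^ (1 / 2 + α / N)`. Integrating `∇φ`
along the rays `t ↦ (x + tθ, t)` and averaging over `|θ| < 1` bounds the left side by
`∫ |∇φ(z, t)| M(z, t) dz dt`, where `M(z, t)` is the measure of `{|θ| < 1, z - tθ ∈ A}`. The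
Cauchy–Schwarz inequality leaves the dual energy `∫ t ^ (2α - 1) M²`, which is computed from
`∫ M(z, t) dz = c |A|` and `M ≤ min (c, |A| t ^ (-N))`.

*Traces* (`exists_hasTrace`, `HasTrace.ae_eq`). From
`|φ(x, y) - φ(x, 0)|² ≤ y ^ (2α) / (2α) ∫ t ^ (1 - 2α) |∂φ/∂y|² dt`, the boundary values of test
functions approximating `w` converge in `L²(D)`, the limit is a trace of `w`, and the trace is
unique.

*Level sets* (`exists_level_estimate`). Let `G` be a smooth odd truncation at height `s`. The
equation tested with `G(φₙ)`, where `φₙ → w` in the energy space, bounds the energy of `G(φₙ)` by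
`L ∫ f G(φₙ(x, 0)) dx + o(1)`. No chain rule for `w` itself is needed, since only the test functions
are truncated. With the trace inequality for `A = {|u| > 2s}`, in the limit,
`s |{|u| > 2s}| ^ (1 / κ) ≤ c ∫_{|u| > s} |f|`.

*Summation over the levels* (`eLpNorm_le_of_level_estimate`). Put `m = q / κ - 1 > 0`. By the layer
cake formula and Markov's inequality the level estimate gives `∫ |u|^q ≤ C (∫ |f| |u|^m) ^ κ`. As
`1 / p + m / q = 1`, Hölder's inequality bounds the right side by
`C ‖f‖_p ^ κ ‖u‖_q ^ (q - κ)`, and the power of `‖u‖_q` is absorbed after cutting `|u|` at a finite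
height.
-/

open MeasureTheory Set Filter Topology
open scoped NNReal ENNReal ContDiff

noncomputable section

namespace ExtensionProblem

variable {N : ℕ}

local notation "𝔼" N => EuclideanSpace ℝ (Fin N)

/-! ### Horizontal gradient and vertical derivative of test functions -/

theorem hasFDerivAt_slice_left {φ : (𝔼 N) × ℝ → ℝ} {X : (𝔼 N) × ℝ}
    (h : DifferentiableAt ℝ φ X) :
    HasFDerivAt (fun x => φ (x, X.2))
      ((fderiv ℝ φ X).comp (ContinuousLinearMap.inl ℝ (𝔼 N) ℝ)) X.1 :=
  HasFDerivAt.comp (g := φ) X.1 (by simpa using h.hasFDerivAt) (hasFDerivAt_prodMk_left X.1 X.2)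

theorem inner_gradX {φ : (𝔼 N) × ℝ → ℝ} {X : (𝔼 N) × ℝ} (h : DifferentiableAt ℝ φ X)
    (v : 𝔼 N) : inner ℝ (gradX φ X) v = fderiv ℝ φ X (v, 0) := by
  have := (hasFDerivAt_slice_left h).fderiv
  simp [gradX, gradient, this]

theorem gradX_eq {φ : (𝔼 N) × ℝ → ℝ} {X : (𝔼 N) × ℝ} (h : DifferentiableAt ℝ φ X) :
    gradX φ X = (InnerProductSpace.toDual ℝ (𝔼 N)).symm
      ((fderiv ℝ φ X).comp (ContinuousLinearMap.inl ℝ (𝔼 N) ℝ)) := by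
  rw [gradX, gradient, (hasFDerivAt_slice_left h).fderiv]

theorem hasDerivAt_slice_right {φ : (𝔼 N) × ℝ → ℝ} {X : (𝔼 N) × ℝ}
    (h : DifferentiableAt ℝ φ X) :
    HasDerivAt (fun y => φ (X.1, y)) (fderiv ℝ φ X (0, 1)) X.2 := by
  have h1 : HasFDerivAt (fun y => φ (X.1, y))
      ((fderiv ℝ φ X).comp (ContinuousLinearMap.inr ℝ (𝔼 N) ℝ)) X.2 :=
    HasFDerivAt.comp (g := φ) X.2 (by simpa using h.hasFDerivAt) (hasFDerivAt_prodMk_right X.1 X.2)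
  simpa using h1.hasDerivAt

theorem derivY_eq {φ : (𝔼 N) × ℝ → ℝ} {X : (𝔼 N) × ℝ} (h : DifferentiableAt ℝ φ X) :
    derivY φ X = fderiv ℝ φ X (0, 1) :=
  (hasDerivAt_slice_right h).deriv

theorem fderiv_eq_inner_gradX_add {φ : (𝔼 N) × ℝ → ℝ} {X : (𝔼 N) × ℝ}
    (h : DifferentiableAt ℝ φ X) (v : 𝔼 N) (s : ℝ) :
    fderiv ℝ φ X (v, s) = inner ℝ (gradX φ X) v + s * derivY φ X := by
  rw [inner_gradX h, derivY_eq h, ← smul_eq_mul, ← map_smul, ← map_add]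
  simp

theorem gradX_comp {φ : (𝔼 N) × ℝ → ℝ} {X : (𝔼 N) × ℝ} {G : ℝ → ℝ}
    (h : DifferentiableAt ℝ φ X) (hG : DifferentiableAt ℝ G (φ X)) :
    gradX (fun Z => G (φ Z)) X = deriv G (φ X) • gradX φ X := by
  have h2 := hG.hasDerivAt.comp_hasFDerivAt X h.hasFDerivAt
  rw [gradX_eq h, gradX_eq (φ := fun Z => G (φ Z)) h2.differentiableAt, ← map_smul]
  congr 1
  ext v
  simp [HasFDerivAt.fderiv (f := fun Z => G (φ Z)) h2]

theorem derivY_comp {φ : (𝔼 N) × ℝ → ℝ} {X : (𝔼 N) × ℝ} {G : ℝ → ℝ}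
    (h : DifferentiableAt ℝ φ X) (hG : DifferentiableAt ℝ G (φ X)) :
    derivY (fun Z => G (φ Z)) X = deriv G (φ X) * derivY φ X := by
  have h2 := hG.hasDerivAt.comp_hasFDerivAt X h.hasFDerivAt
  rw [derivY_eq h, derivY_eq (φ := fun Z => G (φ Z)) h2.differentiableAt,
    HasFDerivAt.fderiv (f := fun Z => G (φ Z)) h2]
  simp

theorem derivY_sub {φ ψ : (𝔼 N) × ℝ → ℝ} {X : (𝔼 N) × ℝ}
    (h : DifferentiableAt ℝ φ X) (h' : DifferentiableAt ℝ ψ X) :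
    derivY (fun Z => φ Z - ψ Z) X = derivY φ X - derivY ψ X := by
  rw [derivY_eq h, derivY_eq h', derivY_eq (h.fun_sub h'), fderiv_fun_sub h h']
  rfl

namespace IsTestFunction

variable {U : Set ((𝔼 N) × ℝ)} {φ ψ : (𝔼 N) × ℝ → ℝ}

theorem differentiable (h : IsTestFunction U φ) : Differentiable ℝ φ :=
  h.smooth.differentiable (by simp)

theorem continuous (h : IsTestFunction U φ) : Continuous φ := h.smooth.continuous

theorem continuous_fderiv (h : IsTestFunction U φ) : Continuous (fderiv ℝ φ) :=
  h.smooth.continuous_fderiv (by simp)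

theorem continuous_gradX (h : IsTestFunction U φ) : Continuous (gradX φ) := by
  rw [show gradX φ = _ from funext fun X => gradX_eq (h.differentiable X)]
  exact (LinearIsometryEquiv.continuous _).comp (h.continuous_fderiv.clm_comp continuous_const)

theorem continuous_derivY (h : IsTestFunction U φ) : Continuous (derivY φ) := by
  rw [show derivY φ = _ from funext fun X => derivY_eq (h.differentiable X)]
  exact h.continuous_fderiv.clm_apply continuous_const

theorem gradX_eq_zero (h : IsTestFunction U φ) {X : (𝔼 N) × ℝ} (hX : X ∉ U) :
    gradX φ X = 0 := by
  rw [gradX_eq (h.differentiable X),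
    fderiv_of_notMem_tsupport (𝕜 := ℝ) (fun hh => hX (h.support_subset hh))]
  simp

theorem derivY_eq_zero (h : IsTestFunction U φ) {X : (𝔼 N) × ℝ} (hX : X ∉ U) :
    derivY φ X = 0 := by
  rw [derivY_eq (h.differentiable X),
    fderiv_of_notMem_tsupport (𝕜 := ℝ) (fun hh => hX (h.support_subset hh))]
  simp

theorem comp (h : IsTestFunction U φ) {G : ℝ → ℝ} (hG : ContDiff ℝ ∞ G) (hG0 : G 0 = 0) :
    IsTestFunction U (fun X => G (φ X)) where
  smooth := hG.comp h.smooth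
  compact_support := h.compact_support.comp_left (g := G) hG0
  support_subset :=
    (closure_mono (Function.support_comp_subset (g := G) hG0 φ)).trans h.support_subset

theorem sub (h : IsTestFunction U φ) (h' : IsTestFunction U ψ) :
    IsTestFunction U (fun X => φ X - ψ X) where
  smooth := h.smooth.sub h'.smooth
  compact_support := h.compact_support.sub h'.compact_support
  support_subset := (tsupport_sub φ ψ).trans (union_subset h.support_subset h'.support_subset)

theorem hasCompactSupport_slice (h : IsTestFunction U φ) (γ : ℝ → 𝔼 N) :
    HasCompactSupport fun t => φ (γ t, t) := by
  refine HasCompactSupport.intro (h.compact_support.isCompact.image continuous_snd) fun t ht => ?_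
  by_contra hne
  exact ht ⟨(γ t, t), subset_tsupport _ hne, rfl⟩

end IsTestFunction

theorem measurable_weight (α : ℝ) :
    Measurable fun X : (𝔼 N) × ℝ => ENNReal.ofReal (X.2 ^ (1 - 2 * α)) := by
  fun_prop

/-- Along the non-tangential ray `t ↦ (x + tθ, t)` the boundary value of a test function is
recovered by integrating its gradient. -/
theorem IsTestFunction.enorm_boundary_le_ray {U : Set ((𝔼 N) × ℝ)} {φ : (𝔼 N) × ℝ → ℝ}
    (h : IsTestFunction U φ) (x θ : 𝔼 N) (hθ : ‖θ‖ ≤ 1) :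
    ‖φ (x, 0)‖ₑ ≤ ∫⁻ t in Ioi (0 : ℝ),
      (‖gradX φ (x + t • θ, t)‖ₑ + ‖derivY φ (x + t • θ, t)‖ₑ) := by
  have hc : ContDiff ℝ 1 fun t : ℝ => φ (x + t • θ, t) :=
    (h.smooth.of_le (by simp)).comp (by fun_prop)
  have hd (t : ℝ) : deriv (fun t : ℝ => φ (x + t • θ, t)) t
      = inner ℝ (gradX φ (x + t • θ, t)) θ + 1 * derivY φ (x + t • θ, t) := by
    rw [← fderiv_eq_inner_gradX_add (h.differentiable _)]
    have h1 : HasDerivAt (fun t : ℝ => (x + t • θ, t)) (θ, 1) t := by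
      simpa using (((hasDerivAt_id t).smul_const θ).const_add x).prodMk (hasDerivAt_id t)
    exact ((h.differentiable _).hasFDerivAt.comp_hasDerivAt t h1).deriv
  have key := HasCompactSupport.integral_Ioi_deriv_eq hc
    (h.hasCompactSupport_slice fun t => x + t • θ) 0
  have : ‖φ (x, 0)‖ₑ = ‖∫ t in Ioi (0 : ℝ), deriv (fun t : ℝ => φ (x + t • θ, t)) t‖ₑ := by
    rw [key]; simp
  rw [this]
  refine (enorm_integral_le_lintegral_enorm _).trans (lintegral_mono fun t => ?_)
  rw [hd t, one_mul]
  refine (enorm_add_le _ _).trans (add_le_add_left ?_ _)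
  rw [enorm_le_iff_norm_le]
  exact (norm_inner_le_norm _ _).trans (mul_le_of_le_one_right (norm_nonneg _) hθ)

/-! ### The trace inequality -/

/-- The weighted Dirichlet energy `∫ y ^ (1 - 2α) |∇φ|²` over the cylinder above `D`, for the
classical gradient. -/
def energy (α : ℝ) (D : Set (𝔼 N)) (φ : (𝔼 N) × ℝ → ℝ) : ℝ≥0∞ :=
  ∫⁻ X, (‖gradX φ X‖ₑ ^ 2 + ‖derivY φ X‖ₑ ^ 2) ∂weightedMeasure α D

/-- Lebesgue measure on the half-space `ℝᴺ × (0, ⊤)`. -/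
def halfSpaceMeasure (N : ℕ) : Measure ((𝔼 N) × ℝ) :=
  (volume : Measure (𝔼 N)).prod (volume.restrict (Ioi (0 : ℝ)))

theorem restrict_cylinder_eq (D : Set (𝔼 N)) :
    (volume : Measure ((𝔼 N) × ℝ)).restrict (cylinder D)
      = (halfSpaceMeasure N).restrict (D ×ˢ univ) := by
  rw [halfSpaceMeasure, ← Measure.prod_restrict, Measure.restrict_univ, Measure.prod_restrict]
  rfl

/-- The energy of a test function is an integral over the half-space, since its gradient vanishes
off the cylinder. -/
theorem energy_eq {α : ℝ} {D : Set (𝔼 N)} (hD : MeasurableSet D) {φ : (𝔼 N) × ℝ → ℝ}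
    (h : IsTestFunction (D ×ˢ univ) φ) :
    energy α D φ = ∫⁻ X, ENNReal.ofReal (X.2 ^ (1 - 2 * α)) *
      (‖gradX φ X‖ₑ ^ 2 + ‖derivY φ X‖ₑ ^ 2) ∂halfSpaceMeasure N := by
  have hm : Measurable fun X => ‖gradX φ X‖ₑ ^ 2 + ‖derivY φ X‖ₑ ^ 2 :=
    (h.continuous_gradX.measurable.enorm.pow_const 2).add
      (h.continuous_derivY.measurable.enorm.pow_const 2)
  rw [energy, weightedMeasure, lintegral_withDensity_eq_lintegral_mul _ (measurable_weight α) hm,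
    restrict_cylinder_eq, ← lintegral_indicator (hD.prod MeasurableSet.univ)]
  refine lintegral_congr fun X => ?_
  by_cases hX : X ∈ D ×ˢ (univ : Set ℝ)
  · rw [indicator_of_mem hX]; rfl
  · rw [indicator_of_notMem hX, h.gradX_eq_zero hX, h.derivY_eq_zero hX]; simp

/-- The integral of `k (z - tθ)` over the unit ball of directions `θ`, at `X = (z, t)`. For the
indicator of a set it measures the directions in which the ray through `(z, t)` starts in the set;
it is `t ^ (-N)` times the integral of `k` over the ball of radius `t` about `z`. -/
def coneMass (k : (𝔼 N) → ℝ≥0∞) (X : (𝔼 N) × ℝ) : ℝ≥0∞ :=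
  ∫⁻ θ in Metric.ball (0 : 𝔼 N) 1, k (X.1 - X.2 • θ)

theorem measurable_coneMass {k : (𝔼 N) → ℝ≥0∞} (hk : Measurable k) : Measurable (coneMass k) :=
  Measurable.lintegral_prod_right' (f := fun p : ((𝔼 N) × ℝ) × (𝔼 N) => k (p.1.1 - p.1.2 • p.2))
    (by fun_prop)

/-- Integration of `g` along all non-tangential rays `t ↦ (x + tθ, t)`, weighted by `k` in the
starting point `x`, is integration of `g` over the half-space against `coneMass k`. -/
theorem lintegral_rays_eq {k : (𝔼 N) → ℝ≥0∞} (hk : Measurable k) {g : (𝔼 N) × ℝ → ℝ≥0∞}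
    (hg : Measurable g) :
    ∫⁻ θ in Metric.ball (0 : 𝔼 N) 1, ∫⁻ x, k x * ∫⁻ t in Ioi (0 : ℝ), g (x + t • θ, t)
      = ∫⁻ X, g X * coneMass k X ∂halfSpaceMeasure N := by
  have h1 (θ : 𝔼 N) : ∫⁻ x, k x * ∫⁻ t in Ioi (0 : ℝ), g (x + t • θ, t)
      = ∫⁻ t in Ioi (0 : ℝ), ∫⁻ x, k x * g (x + t • θ, t) := by
    rw [← lintegral_lintegral_swap (by fun_prop)]
    exact lintegral_congr fun x => (lintegral_const_mul _ (by fun_prop)).symm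
  have h2 (t : ℝ) (θ : 𝔼 N) : ∫⁻ x, k x * g (x + t • θ, t) = ∫⁻ z, g (z, t) * k (z - t • θ) := by
    rw [← lintegral_add_right_eq_self (fun z => g (z, t) * k (z - t • θ)) (t • θ)]
    simp [mul_comm]
  have hm := (measurable_coneMass hk)
  simp_rw [h1, h2]
  rw [halfSpaceMeasure, lintegral_prod_symm' (fun X => g X * coneMass k X) (hg.mul hm),
    lintegral_lintegral_swap
    (Measurable.aemeasurable (Measurable.lintegral_prod_right'
      (f := fun p : ((𝔼 N) × ℝ) × (𝔼 N) => g (p.2, p.1.2) * k (p.2 - p.1.2 • p.1.1))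
      (by fun_prop)))]
  refine lintegral_congr fun t => ?_
  rw [lintegral_lintegral_swap (by fun_prop)]
  refine lintegral_congr fun z => ?_
  rw [lintegral_const_mul _ (by fun_prop)]
  rfl

theorem coneMass_le_of_le_one {k : (𝔼 N) → ℝ≥0∞} (hk : ∀ x, k x ≤ 1) (X : (𝔼 N) × ℝ) :
    coneMass k X ≤ volume (Metric.ball (0 : 𝔼 N) 1) := by
  refine (lintegral_mono (g := fun _ => 1) fun θ => hk _).trans ?_
  simp

theorem coneMass_le_mul_lintegral {k : (𝔼 N) → ℝ≥0∞} (hk : Measurable k) (z : 𝔼 N) {t : ℝ}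
    (ht : 0 < t) : coneMass k (z, t) ≤ ENNReal.ofReal (t ^ (-(N : ℝ))) * ∫⁻ x, k x := by
  have h1 : Measure.map (fun θ : 𝔼 N => t • θ) volume
      = ENNReal.ofReal (t ^ (-(N : ℝ))) • (volume : Measure (𝔼 N)) := by
    rw [Measure.map_addHaar_smul _ ht.ne', finrank_euclideanSpace_fin, Real.rpow_neg ht.le,
      Real.rpow_natCast, abs_of_pos (by positivity)]
  have h2 : ∫⁻ θ : 𝔼 N, k (z - t • θ) = ENNReal.ofReal (t ^ (-(N : ℝ))) * ∫⁻ x, k x := by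
    rw [← lintegral_map (f := fun x => k (z - x)) (g := fun θ : 𝔼 N => t • θ) (by fun_prop)
      (by fun_prop), h1, lintegral_smul_measure, lintegral_sub_left_eq_self]
    rfl
  rw [← h2]
  exact setLIntegral_le_lintegral _ _

theorem lintegral_coneMass {k : (𝔼 N) → ℝ≥0∞} (hk : Measurable k) (t : ℝ) :
    ∫⁻ z, coneMass k (z, t) = volume (Metric.ball (0 : 𝔼 N) 1) * ∫⁻ x, k x := by
  unfold coneMass
  rw [lintegral_lintegral_swap (by fun_prop)]
  simp_rw [lintegral_sub_right_eq_self]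
  simp [mul_comm]

theorem lintegral_rpow_Ioc {r R : ℝ} (hr : 0 < r) (hR : 0 ≤ R) :
    ∫⁻ t in Ioc 0 R, ENNReal.ofReal (t ^ (r - 1)) = ENNReal.ofReal (R ^ r / r) := by
  rw [← ofReal_integral_eq_lintegral_ofReal
    ((intervalIntegrable_iff_integrableOn_Ioc_of_le hR).1
      (intervalIntegral.intervalIntegrable_rpow' (by linarith)))
    ((ae_restrict_mem measurableSet_Ioc).mono fun t ht => Real.rpow_nonneg ht.1.le _),
    ← intervalIntegral.integral_of_le hR, integral_rpow (Or.inl (by linarith))]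
  simp [Real.zero_rpow hr.ne']

theorem lintegral_rpow_Ioi {r R : ℝ} (hr : r < 0) (hR : 0 < R) :
    ∫⁻ t in Ioi R, ENNReal.ofReal (t ^ (r - 1)) = ENNReal.ofReal (R ^ r / -r) := by
  rw [← ofReal_integral_eq_lintegral_ofReal
    (integrableOn_Ioi_rpow_of_lt (by linarith) hR)
    ((ae_restrict_mem measurableSet_Ioi).mono fun t ht => Real.rpow_nonneg (hR.le.trans ht.le) _),
    integral_Ioi_rpow_of_lt (by linarith) hR]
  simp [neg_div, div_neg]

/-- The dual energy of the cone averages of a set: at heights `t ≤ |A| ^ (1/N)` the average is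
bounded by a constant, above by `|A| t ^ (-N)`. -/
theorem exists_lintegral_coneMass_sq_le {α : ℝ} (hα : 0 < α) (hN : 2 * α < N) :
    ∃ K : ℝ≥0, ∀ A : Set (𝔼 N), MeasurableSet A → volume A ≠ 0 → volume A ≠ ⊤ →
      ∫⁻ X, ENNReal.ofReal (X.2 ^ (2 * α - 1)) * coneMass (A.indicator 1) X ^ 2
        ∂halfSpaceMeasure N ≤ K * volume A ^ (1 + 2 * α / N) := by
  obtain ⟨b₁, hb⟩ : ∃ b₁ : ℝ≥0, volume (Metric.ball (0 : 𝔼 N) 1) = b₁ :=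
    ⟨_, (ENNReal.coe_toNNReal measure_ball_lt_top.ne).symm⟩
  have hN0 : (0 : ℝ) < N := by linarith
  refine ⟨b₁ * (b₁ * (1 / (2 * α)).toNNReal + (1 / (N - 2 * α)).toNNReal), fun A hA hA0 hAt => ?_⟩
  obtain ⟨V, hV⟩ : ∃ V : ℝ≥0, volume A = V := ⟨_, (ENNReal.coe_toNNReal hAt).symm⟩
  have hV0 : (0 : ℝ) < V := by
    rw [hV] at hA0; exact_mod_cast pos_iff_ne_zero.2 (by simpa using hA0)
  have hk : Measurable (A.indicator (1 : (𝔼 N) → ℝ≥0∞)) := measurable_one.indicator hA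
  have hk1 (x : 𝔼 N) : A.indicator (1 : (𝔼 N) → ℝ≥0∞) x ≤ 1 := indicator_le_self' (by simp) x
  have hkI : ∫⁻ x, A.indicator (1 : (𝔼 N) → ℝ≥0∞) x = V := by
    rw [lintegral_indicator_one hA, hV]
  set M := coneMass (A.indicator (1 : (𝔼 N) → ℝ≥0∞)) with hM
  have hMm : Measurable M := measurable_coneMass hk
  -- the height at which `|A| t ^ (-N) = 1`, where the two bounds of `coneMass` are comparable
  set R : ℝ := (V : ℝ) ^ (1 / (N : ℝ)) with hR
  have hR0 : 0 < R := by positivity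
  have hslice (t : ℝ) (c : ℝ≥0∞) (hc : ∀ z, M (z, t) ≤ c) :
      ∫⁻ z, ENNReal.ofReal (t ^ (2 * α - 1)) * M (z, t) ^ 2
        ≤ (b₁ * V) * (c * ENNReal.ofReal (t ^ (2 * α - 1))) := by
    calc ∫⁻ z, ENNReal.ofReal (t ^ (2 * α - 1)) * M (z, t) ^ 2
        ≤ ∫⁻ z, ENNReal.ofReal (t ^ (2 * α - 1)) * c * M (z, t) := by
          refine lintegral_mono fun z => ?_
          rw [mul_assoc, sq]
          gcongr
          exact hc z
      _ = ENNReal.ofReal (t ^ (2 * α - 1)) * c * (b₁ * V) := by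
          rw [lintegral_const_mul _ (by fun_prop), lintegral_coneMass hk, hb, hkI]
      _ = _ := by ring
  have hlow : ∫⁻ t in Ioc 0 R, ∫⁻ z, ENNReal.ofReal (t ^ (2 * α - 1)) * M (z, t) ^ 2
      ≤ (b₁ * V) * (b₁ * ENNReal.ofReal (R ^ (2 * α) / (2 * α))) := by
    refine (lintegral_mono fun t => hslice t b₁ fun z => ?_).trans ?_
    · rw [← hb]; exact coneMass_le_of_le_one hk1 _
    · rw [lintegral_const_mul _ (by fun_prop), lintegral_const_mul _ (by fun_prop),
        lintegral_rpow_Ioc (by linarith) hR0.le]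
  have hhigh : ∫⁻ t in Ioi R, ∫⁻ z, ENNReal.ofReal (t ^ (2 * α - 1)) * M (z, t) ^ 2
      ≤ (b₁ * V) * (V * ENNReal.ofReal (R ^ (2 * α - N) / (N - 2 * α))) := by
    have : ∀ t ∈ Ioi R, ∫⁻ z, ENNReal.ofReal (t ^ (2 * α - 1)) * M (z, t) ^ 2
        ≤ (b₁ * V) * (V * ENNReal.ofReal (t ^ ((2 * α - N) - 1))) := by
      intro t ht
      have ht0 : 0 < t := hR0.trans ht
      refine (hslice t _ fun z => coneMass_le_mul_lintegral hk z ht0).trans (le_of_eq ?_)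
      have e : ENNReal.ofReal (t ^ ((2 * α - N) - 1))
          = ENNReal.ofReal (t ^ (-(N : ℝ))) * ENNReal.ofReal (t ^ (2 * α - 1)) := by
        rw [← ENNReal.ofReal_mul (by positivity), ← Real.rpow_add ht0]
        congr 2
        ring
      rw [hkI, e]
      ring
    refine (setLIntegral_mono (by fun_prop) this).trans ?_
    rw [lintegral_const_mul _ (by fun_prop), lintegral_const_mul _ (by fun_prop),
      lintegral_rpow_Ioi (by linarith) hR0, neg_sub]
  rw [halfSpaceMeasure, lintegral_prod_symm' _ (by fun_prop), ← Ioc_union_Ioi_eq_Ioi hR0.le]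
  refine (lintegral_union_le _ _ _).trans ((add_le_add hlow hhigh).trans (le_of_eq ?_))
  have e1 : R ^ (2 * α) = (V : ℝ) ^ (2 * α / N) := by
    rw [hR, ← Real.rpow_mul hV0.le]; congr 1; ring
  have e2 : (V : ℝ) * R ^ (2 * α - N) = (V : ℝ) ^ (2 * α / N) := by
    rw [hR, ← Real.rpow_mul hV0.le]
    nth_rewrite 1 [← Real.rpow_one (V : ℝ)]
    rw [← Real.rpow_add hV0]; congr 1; field_simp; ring
  rw [hV, ENNReal.rpow_add _ _ (by simpa using hV0.ne') (by simp), ENNReal.rpow_one]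
  have e3 : (V : ℝ≥0∞) * ENNReal.ofReal (R ^ (2 * α - N) / (N - 2 * α))
      = (V : ℝ≥0∞) ^ (2 * α / N) * ((1 / (N - 2 * α)).toNNReal : ℝ≥0∞) := by
    rw [← ENNReal.ofReal_coe_nnreal, ← ENNReal.ofReal_mul hV0.le, ← mul_div_assoc, e2,
      ENNReal.ofReal_rpow_of_pos hV0, div_eq_mul_one_div,
      ENNReal.ofReal_mul (by positivity)]
    rfl
  have e4 : ENNReal.ofReal (R ^ (2 * α) / (2 * α))
      = (V : ℝ≥0∞) ^ (2 * α / N) * ((1 / (2 * α)).toNNReal : ℝ≥0∞) := by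
    rw [e1, div_eq_mul_one_div, ENNReal.ofReal_mul (by positivity),
      ← ENNReal.ofReal_rpow_of_pos hV0, ENNReal.ofReal_coe_nnreal]
    rfl
  rw [e3, e4]
  push_cast
  ring

theorem ennreal_add_sq_le (a b : ℝ≥0∞) : (a + b) ^ 2 ≤ 2 * (a ^ 2 + b ^ 2) := by
  have := ENNReal.rpow_add_le_mul_rpow_add_rpow a b (p := 2) (by norm_num)
  norm_num at this
  simpa using this

/-- Cauchy–Schwarz with the weight split as `1 = y ^ (r / 2) * y ^ (-r / 2)`. -/
theorem lintegral_mul_le_weighted {Ω : Type*} [MeasurableSpace Ω] {μ : Measure Ω} (r : ℝ)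
    {y : Ω → ℝ} (hy : Measurable y) (hpos : ∀ᵐ X ∂μ, 0 < y X) {g k : Ω → ℝ≥0∞} (hg : Measurable g)
    (hk : Measurable k) :
    ∫⁻ X, g X * k X ∂μ ≤ (∫⁻ X, ENNReal.ofReal (y X ^ r) * g X ^ 2 ∂μ) ^ (1 / 2 : ℝ) *
      (∫⁻ X, ENNReal.ofReal (y X ^ (-r)) * k X ^ 2 ∂μ) ^ (1 / 2 : ℝ) := by
  have hsq (r : ℝ) {y : ℝ} (hy : 0 < y) (c : ℝ≥0∞) :
      (ENNReal.ofReal (y ^ (r / 2)) * c) ^ (2 : ℝ) = ENNReal.ofReal (y ^ r) * c ^ 2 := by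
    have e : ENNReal.ofReal (y ^ r) = ENNReal.ofReal (y ^ (r / 2)) ^ 2 := by
      rw [← ENNReal.ofReal_pow (by positivity), ← Real.rpow_natCast, ← Real.rpow_mul hy.le]
      congr 2; push_cast; ring
    rw [e, ← mul_pow, ENNReal.rpow_two]
  calc ∫⁻ X, g X * k X ∂μ
      = ∫⁻ X, ((fun X => ENNReal.ofReal (y X ^ (r / 2)) * g X) *
          fun X => ENNReal.ofReal (y X ^ (-r / 2)) * k X) X ∂μ := by
        refine lintegral_congr_ae (hpos.mono fun X hX => ?_)
        have : ENNReal.ofReal (y X ^ (r / 2)) * ENNReal.ofReal (y X ^ (-r / 2)) = 1 := by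
          rw [← ENNReal.ofReal_mul (by positivity), ← Real.rpow_add hX, ← add_div]
          simp
        simp only [Pi.mul_apply]
        rw [mul_mul_mul_comm, this, one_mul]
    _ ≤ _ := ENNReal.lintegral_mul_le_Lp_mul_Lq _ Real.HolderConjugate.two_two
          (by fun_prop) (by fun_prop)
    _ = _ := by
        congr 2 <;> exact lintegral_congr_ae (hpos.mono fun X hX => hsq _ hX _)

/-- Trace Sobolev inequality on `ℝᴺ × (0, ⊤)` with the weight `y ^ (1 - 2α)`, in restricted weak
form: the boundary values are tested against indicators of sets only. -/
theorem exists_lintegral_trace_le {α : ℝ} (hα : 0 < α) (hN : 2 * α < N) :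
    ∃ C : ℝ≥0, ∀ (D : Set (𝔼 N)) (φ : (𝔼 N) × ℝ → ℝ), MeasurableSet D →
      IsTestFunction (D ×ˢ univ) φ → ∀ A : Set (𝔼 N), MeasurableSet A → volume A ≠ ⊤ →
      ∫⁻ x in A, ‖φ (x, 0)‖ₑ
        ≤ C * energy α D φ ^ (1 / 2 : ℝ) * volume A ^ (1 / 2 + α / N) := by
  obtain ⟨K, hK⟩ := exists_lintegral_coneMass_sq_le (N := N) hα hN
  obtain ⟨b₁, hb⟩ : ∃ b₁ : ℝ≥0, volume (Metric.ball (0 : 𝔼 N) 1) = b₁ :=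
    ⟨_, (ENNReal.coe_toNNReal measure_ball_lt_top.ne).symm⟩
  have hb0 : b₁ ≠ 0 := by
    have := (Metric.measure_ball_pos volume (0 : 𝔼 N) one_pos).ne'
    rw [hb] at this; simpa using this
  refine ⟨b₁⁻¹ * (2 * K) ^ (1 / 2 : ℝ), fun D φ hD h A hA hAt => ?_⟩
  rcases eq_or_ne (volume A) 0 with hA0 | hA0
  · rw [Measure.restrict_eq_zero.2 hA0]; simp
  set k := A.indicator (1 : (𝔼 N) → ℝ≥0∞) with hkdef
  have hk : Measurable k := measurable_one.indicator hA
  set g : (𝔼 N) × ℝ → ℝ≥0∞ := fun X => ‖gradX φ X‖ₑ + ‖derivY φ X‖ₑ with hgdef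
  have hg : Measurable g :=
    h.continuous_gradX.measurable.enorm.add h.continuous_derivY.measurable.enorm
  have hM : Measurable (coneMass k) := measurable_coneMass hk
  have hrays : b₁ * ∫⁻ x in A, ‖φ (x, 0)‖ₑ ≤ ∫⁻ X, g X * coneMass k X ∂halfSpaceMeasure N := by
    rw [← lintegral_rays_eq hk hg, mul_comm, ← hb]
    have e : ∫⁻ x in A, ‖φ (x, 0)‖ₑ = ∫⁻ x, k x * ‖φ (x, 0)‖ₑ := by
      rw [← lintegral_indicator hA]
      refine lintegral_congr fun x => ?_
      by_cases hx : x ∈ A <;> simp [hkdef, hx]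
    rw [e, ← setLIntegral_const]
    refine setLIntegral_mono' measurableSet_ball fun θ hθ => lintegral_mono fun x => ?_
    gcongr
    exact h.enorm_boundary_le_ray x θ (by simpa using (mem_ball_zero_iff.1 hθ).le)
  have hdual : ∫⁻ X, g X * coneMass k X ∂halfSpaceMeasure N
      ≤ (2 * energy α D φ) ^ (1 / 2 : ℝ) * (K * volume A ^ (1 + 2 * α / N)) ^ (1 / 2 : ℝ) := by
    refine (lintegral_mul_le_weighted (1 - 2 * α) measurable_snd
      (Measure.quasiMeasurePreserving_snd.ae (ae_restrict_mem measurableSet_Ioi)) hg hM).trans ?_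
    rw [neg_sub]
    gcongr
    · rw [energy_eq hD h, ← lintegral_const_mul' _ _ (by simp)]
      refine lintegral_mono fun X => ?_
      rw [mul_left_comm]
      gcongr
      exact ennreal_add_sq_le _ _
    · exact hK A hA hA0 hAt
  have hb' : (b₁ : ℝ≥0∞) ≠ 0 := by simpa using hb0
  calc ∫⁻ x in A, ‖φ (x, 0)‖ₑ = (b₁ : ℝ≥0∞)⁻¹ * (b₁ * ∫⁻ x in A, ‖φ (x, 0)‖ₑ) := by
        rw [← mul_assoc, ENNReal.inv_mul_cancel hb' (by simp), one_mul]
    _ ≤ (b₁ : ℝ≥0∞)⁻¹ * ((2 * energy α D φ) ^ (1 / 2 : ℝ) *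
          (K * volume A ^ (1 + 2 * α / N)) ^ (1 / 2 : ℝ)) := by
        exact mul_le_mul' le_rfl (hrays.trans hdual)
    _ = _ := by
        have hh : (0 : ℝ) ≤ 1 / 2 := by norm_num
        rw [ENNReal.mul_rpow_of_nonneg _ _ hh, ENNReal.mul_rpow_of_nonneg _ _ hh,
          ← ENNReal.rpow_mul]
        push_cast
        rw [ENNReal.coe_inv hb0, ENNReal.coe_rpow_of_nonneg _ hh, ENNReal.coe_mul,
          ENNReal.mul_rpow_of_nonneg _ _ hh,
          show (1 + 2 * α / N) * (1 / 2) = 1 / 2 + α / N by ring]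
        push_cast
        ring

/-! ### Existence and uniqueness of the trace -/

theorem rpow_half_sq (a : ℝ≥0∞) : (a ^ (1 / 2 : ℝ)) ^ 2 = a := by
  rw [← ENNReal.rpow_natCast, ← ENNReal.rpow_mul]; simp

theorem sq_le_sq_ennreal {a b : ℝ≥0∞} : a ^ 2 ≤ b ^ 2 ↔ a ≤ b :=
  ENNReal.pow_le_pow_left_iff two_ne_zero

theorem eLpNorm_two_sq {Ω F : Type*} [MeasurableSpace Ω] [NormedAddCommGroup F] (μ : Measure Ω)
    (g : Ω → F) : eLpNorm g 2 μ ^ 2 = ∫⁻ x, ‖g x‖ₑ ^ 2 ∂μ := by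
  rw [eLpNorm_eq_lintegral_rpow_enorm_toReal (by simp) (by simp), ← ENNReal.rpow_natCast,
    ← ENNReal.rpow_mul]
  simp

theorem lintegral_weightedMeasure (α : ℝ) (D : Set (𝔼 N)) {F : (𝔼 N) × ℝ → ℝ≥0∞}
    (hF : Measurable F) :
    ∫⁻ X, F X ∂weightedMeasure α D
      = ∫⁻ x in D, ∫⁻ t in Ioi (0 : ℝ), ENNReal.ofReal (t ^ (1 - 2 * α)) * F (x, t) := by
  have hm := measurable_weight (N := N) α
  rw [weightedMeasure, lintegral_withDensity_eq_lintegral_mul _ hm hF, cylinder,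
    Measure.volume_eq_prod, ← Measure.prod_restrict, lintegral_prod _ (by fun_prop)]
  rfl

/-- Fundamental theorem of calculus on a vertical segment; the weight is compensated by
`∫ t ^ (2α - 1) dt = y ^ (2α) / (2α)` over `(0, y)`. -/
theorem IsTestFunction.enorm_sub_boundary_sq_le {α : ℝ} (hα : 0 < α) {U : Set ((𝔼 N) × ℝ)}
    {φ : (𝔼 N) × ℝ → ℝ} (h : IsTestFunction U φ) (x : 𝔼 N) {y : ℝ} (hy : 0 < y) :
    ‖φ (x, y) - φ (x, 0)‖ₑ ^ 2 ≤ ENNReal.ofReal (y ^ (2 * α) / (2 * α)) *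
      ∫⁻ t in Ioi (0 : ℝ), ENNReal.ofReal (t ^ (1 - 2 * α)) * ‖derivY φ (x, t)‖ₑ ^ 2 := by
  have hcont : Continuous fun t => derivY φ (x, t) := h.continuous_derivY.comp (by fun_prop)
  have h1 : ‖φ (x, y) - φ (x, 0)‖ₑ ≤ ∫⁻ t in Ioc 0 y, ‖derivY φ (x, t)‖ₑ * 1 := by
    rw [← intervalIntegral.integral_eq_sub_of_hasDerivAt (f := fun t => φ (x, t))
      (f' := fun t => derivY φ (x, t)) (fun t _ => by
        rw [derivY_eq (h.differentiable _)]
        exact hasDerivAt_slice_right (X := (x, t)) (h.differentiable _))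
      (hcont.intervalIntegrable _ _), intervalIntegral.integral_of_le hy.le]
    simpa using enorm_integral_le_lintegral_enorm _
  have h2 := h1.trans (lintegral_mul_le_weighted (1 - 2 * α) measurable_id
    ((ae_restrict_mem measurableSet_Ioc).mono fun t ht => ht.1) hcont.measurable.enorm
    measurable_const)
  refine (pow_le_pow_left' h2 2).trans ?_
  rw [mul_pow, rpow_half_sq, rpow_half_sq, mul_comm]
  refine mul_le_mul' (le_of_eq ?_) (lintegral_mono_set Ioc_subset_Ioi_self)
  simp only [id, one_pow, mul_one, neg_sub]
  rw [lintegral_rpow_Ioc (by linarith) hy.le]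

theorem restrict_prod_Ioo (D : Set (𝔼 N)) (ε : ℝ) :
    (volume : Measure ((𝔼 N) × ℝ)).restrict (D ×ˢ Ioo 0 ε)
      = (volume.restrict D).prod (volume.restrict (Ioo 0 ε)) := by
  rw [Measure.volume_eq_prod, Measure.prod_restrict]

theorem eLpNorm_comp_fst_restrict_Ioo (D : Set (𝔼 N)) {v : (𝔼 N) → ℝ}
    (hv : AEStronglyMeasurable v (volume.restrict D)) (ε : ℝ) :
    eLpNorm (fun X : (𝔼 N) × ℝ => v X.1) 2 (volume.restrict (D ×ˢ Ioo 0 ε)) ^ 2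
      = ENNReal.ofReal ε * eLpNorm v 2 (volume.restrict D) ^ 2 := by
  rw [eLpNorm_two_sq, eLpNorm_two_sq, restrict_prod_Ioo,
    lintegral_prod _ (hv.enorm.comp_fst.pow_const 2)]
  simp [lintegral_const_mul'' _ (hv.enorm.pow_const 2), mul_comm (_ ^ 2)]

theorem IsTestFunction.eLpNorm_sub_boundary_le {α : ℝ} (hα : 0 < α) {U : Set ((𝔼 N) × ℝ)}
    {φ : (𝔼 N) × ℝ → ℝ} (h : IsTestFunction U φ) (D : Set (𝔼 N)) (ε : ℝ) :
    eLpNorm (fun X : (𝔼 N) × ℝ => φ X - φ (X.1, 0)) 2 (volume.restrict (D ×ˢ Ioo 0 ε)) ^ 2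
      ≤ ENNReal.ofReal ε * ENNReal.ofReal (ε ^ (2 * α) / (2 * α)) *
        eLpNorm (derivY φ) 2 (weightedMeasure α D) ^ 2 := by
  have hc := h.continuous
  have hm : Measurable (derivY φ) := h.continuous_derivY.measurable
  rw [eLpNorm_two_sq, eLpNorm_two_sq, lintegral_weightedMeasure α D (by fun_prop),
    restrict_prod_Ioo, lintegral_prod_symm' _ (by fun_prop)]
  set J := ∫⁻ x in D, ∫⁻ t in Ioi (0 : ℝ),
    ENNReal.ofReal (t ^ (1 - 2 * α)) * ‖derivY φ (x, t)‖ₑ ^ 2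
  calc ∫⁻ y in Ioo 0 ε, ∫⁻ x in D, ‖φ (x, y) - φ (x, 0)‖ₑ ^ 2
      ≤ ∫⁻ y in Ioo 0 ε, ENNReal.ofReal (ε ^ (2 * α) / (2 * α)) * J := by
        refine setLIntegral_mono' measurableSet_Ioo fun y hy => ?_
        rw [← lintegral_const_mul' _ _ (by simp)]
        refine lintegral_mono fun x => (h.enorm_sub_boundary_sq_le hα x hy.1).trans ?_
        gcongr
        · exact hy.1.le
        · exact hy.2.le
    _ = _ := by simp; ring

/-- Trace estimate in `L²(D)`, by the energy in the vertical direction. -/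
theorem IsTestFunction.eLpNorm_boundary_le {α : ℝ} (hα : 0 < α) {U : Set ((𝔼 N) × ℝ)}
    {φ : (𝔼 N) × ℝ → ℝ} (h : IsTestFunction U φ) (D : Set (𝔼 N)) :
    eLpNorm (fun x => φ (x, 0)) 2 (volume.restrict D)
      ≤ eLpNorm φ 2 (volume.restrict (cylinder D)) +
        ENNReal.ofReal (1 / (2 * α)) ^ (1 / 2 : ℝ) *
          eLpNorm (derivY φ) 2 (weightedMeasure α D) := by
  have hc := h.continuous
  have h1 : eLpNorm (fun X : (𝔼 N) × ℝ => φ X - φ (X.1, 0)) 2 (volume.restrict (D ×ˢ Ioo 0 1))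
      ≤ ENNReal.ofReal (1 / (2 * α)) ^ (1 / 2 : ℝ) *
        eLpNorm (derivY φ) 2 (weightedMeasure α D) := by
    rw [← sq_le_sq_ennreal, mul_pow, rpow_half_sq]
    simpa using h.eLpNorm_sub_boundary_le hα D 1
  have h2 : eLpNorm (fun x => φ (x, 0)) 2 (volume.restrict D)
      ≤ eLpNorm (fun X : (𝔼 N) × ℝ => φ (X.1, 0)) 2 (volume.restrict (D ×ˢ Ioo 0 1)) := by
    rw [← sq_le_sq_ennreal, eLpNorm_comp_fst_restrict_Ioo D (v := fun x => φ (x, 0))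
      (by fun_prop) 1]
    simp
  have h3 := eLpNorm_sub_le (f := φ) (g := fun X : (𝔼 N) × ℝ => φ X - φ (X.1, 0)) (p := 2)
    (μ := volume.restrict (D ×ˢ Ioo 0 1)) (by fun_prop) (by fun_prop) (by norm_num)
  rw [show φ - (fun X : (𝔼 N) × ℝ => φ X - φ (X.1, 0)) = fun X => φ (X.1, 0) by
    ext X; simp] at h3
  exact h2.trans (h3.trans (add_le_add (eLpNorm_mono_measure _
    (Measure.restrict_mono (Set.prod_mono le_rfl Ioo_subset_Ioi_self) le_rfl)) h1))

/-- The mean square of `u - v` over `D × (0, ε)` does not depend on `ε`, and tends to zero. -/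
theorem HasTrace.ae_eq {D : Set (𝔼 N)} {w : (𝔼 N) × ℝ → ℝ} {u v : (𝔼 N) → ℝ}
    (hw : AEStronglyMeasurable w (volume.restrict (cylinder D)))
    (hu : HasTrace D w u) (hv : HasTrace D w v) : u =ᵐ[volume.restrict D] v := by
  have hum := hu.memLp.1
  have hvm := hv.memLp.1
  have hlim := (ENNReal.Tendsto.const_mul (a := 2) (hu.tendsto.add hv.tendsto)
    (Or.inr (by simp)))
  rw [add_zero, mul_zero] at hlim
  have key : eLpNorm (fun x => u x - v x) 2 (volume.restrict D) ^ 2 ≤ 0 := by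
    refine ge_of_tendsto hlim (eventually_mem_nhdsWithin.mono fun ε (hε : 0 < ε) => ?_)
    have hsub : D ×ˢ Ioo 0 ε ⊆ cylinder D := Set.prod_mono le_rfl Ioo_subset_Ioi_self
    have hwm := hw.mono_measure (Measure.restrict_mono hsub le_rfl)
    have humX : AEStronglyMeasurable (fun X : (𝔼 N) × ℝ => u X.1)
        (volume.restrict (D ×ˢ Ioo 0 ε)) := by
      rw [restrict_prod_Ioo]; exact hum.comp_fst
    have hle : eLpNorm (fun X : (𝔼 N) × ℝ => u X.1 - v X.1) 2 (volume.restrict (D ×ˢ Ioo 0 ε)) ^ 2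
        ≤ 2 * ((∫⁻ X in D ×ˢ Ioo 0 ε, ‖w X - u X.1‖ₑ ^ 2)
          + ∫⁻ X in D ×ˢ Ioo 0 ε, ‖w X - v X.1‖ₑ ^ 2) := by
      rw [eLpNorm_two_sq, ← lintegral_add_left' (f := fun X => ‖w X - u X.1‖ₑ ^ 2)
        ((hwm.sub humX).enorm.pow_const 2),
        ← lintegral_const_mul' _ _ (by simp)]
      refine lintegral_mono fun X => le_trans ?_ (ennreal_add_sq_le _ _)
      gcongr
      rw [show u X.1 - v X.1 = (w X - v X.1) - (w X - u X.1) by ring, add_comm]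
      exact enorm_sub_le
    rw [eLpNorm_comp_fst_restrict_Ioo D (v := fun x => u x - v x) (hum.sub hvm)] at hle
    have hcancel : ENNReal.ofReal ε⁻¹ * ENNReal.ofReal ε = 1 := by
      rw [← ENNReal.ofReal_mul (by positivity), inv_mul_cancel₀ hε.ne', ENNReal.ofReal_one]
    calc _ = ENNReal.ofReal ε⁻¹ * (ENNReal.ofReal ε *
          eLpNorm (fun x => u x - v x) 2 (volume.restrict D) ^ 2) := by
          rw [← mul_assoc, hcancel, one_mul]
      _ ≤ _ := mul_le_mul' le_rfl hle
      _ = _ := by ring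
  have h0 : eLpNorm (fun x => u x - v x) 2 (volume.restrict D) = 0 := by simpa using key
  exact ((eLpNorm_eq_zero_iff (f := fun x => u x - v x) (hum.sub hvm) (by simp)).1 h0).mono
    fun x hx => sub_eq_zero.1 hx

theorem IsTestFunction.hasCompactSupport_boundary {U : Set ((𝔼 N) × ℝ)} {φ : (𝔼 N) × ℝ → ℝ}
    (h : IsTestFunction U φ) : HasCompactSupport fun x : 𝔼 N => φ (x, 0) := by
  refine HasCompactSupport.intro (h.compact_support.isCompact.image continuous_fst) fun x hx => ?_
  by_contra hne
  exact hx ⟨(x, 0), subset_tsupport _ hne, rfl⟩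

/-- The energy space has traces, and the traces of the approximating test functions converge
to them. -/
theorem exists_hasTrace {α : ℝ} (hα : 0 < α) {D : Set (𝔼 N)} {w : (𝔼 N) × ℝ → ℝ}
    {Gy : (𝔼 N) × ℝ → ℝ} (hw : MemLp w 2 (volume.restrict (cylinder D)))
    (hGy : MemLp Gy 2 (weightedMeasure α D)) {U : Set ((𝔼 N) × ℝ)} {φ : ℕ → (𝔼 N) × ℝ → ℝ}
    (hφ : ∀ n, IsTestFunction U (φ n))
    (hφw : Tendsto (fun n => eLpNorm (fun X => φ n X - w X) 2 (volume.restrict (cylinder D)))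
      atTop (𝓝 0))
    (hφG : Tendsto (fun n => eLpNorm (fun X => derivY (φ n) X - Gy X) 2 (weightedMeasure α D))
      atTop (𝓝 0)) :
    ∃ u, HasTrace D w u ∧
      Tendsto (fun n => eLpNorm (fun x => φ n (x, 0) - u x) 2 (volume.restrict D))
        atTop (𝓝 0) := by
  set c : ℝ≥0∞ := ENNReal.ofReal (1 / (2 * α)) ^ (1 / 2 : ℝ)
  have hc : c ≠ ⊤ := ENNReal.rpow_ne_top_of_nonneg (by norm_num) (by simp)
  have hwm := hw.1
  have hGm := hGy.1
  have hφm (n : ℕ) : Continuous (φ n) := (hφ n).continuous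
  have hum (n : ℕ) : MemLp (fun x => φ n (x, 0)) 2 (volume.restrict D) :=
    (Continuous.memLp_of_hasCompactSupport (by fun_prop)
      (hφ n).hasCompactSupport_boundary).restrict D
  set e : ℕ → ℝ≥0∞ := fun n => eLpNorm (fun X => φ n X - w X) 2 (volume.restrict (cylinder D)) +
    c * eLpNorm (fun X => derivY (φ n) X - Gy X) 2 (weightedMeasure α D) with he
  have he0 : Tendsto e atTop (𝓝 0) := by
    simpa using hφw.add (ENNReal.Tendsto.const_mul hφG (Or.inr hc))
  have hcauchy (n m : ℕ) :
      eLpNorm (fun x => φ n (x, 0) - φ m (x, 0)) 2 (volume.restrict D) ≤ e n + e m := by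
    refine (((hφ n).sub (hφ m)).eLpNorm_boundary_le hα D).trans ?_
    have h1 := eLpNorm_sub_le (f := fun X => φ n X - w X) (g := fun X => φ m X - w X) (p := 2)
      (μ := volume.restrict (cylinder D)) (by fun_prop) (by fun_prop) (by norm_num)
    have h2 := eLpNorm_sub_le (f := fun X => derivY (φ n) X - Gy X)
      (g := fun X => derivY (φ m) X - Gy X) (p := 2) (μ := weightedMeasure α D)
      ((hφ n).continuous_derivY.aestronglyMeasurable.sub hGm)
      ((hφ m).continuous_derivY.aestronglyMeasurable.sub hGm) (by norm_num)
    rw [show (fun X => φ n X - w X) - (fun X => φ m X - w X) = fun X => φ n X - φ m X by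
      ext X; simp] at h1
    rw [show (fun X => derivY (φ n) X - Gy X) - (fun X => derivY (φ m) X - Gy X)
      = derivY fun X => φ n X - φ m X by
        ext X
        rw [derivY_sub ((hφ n).differentiable X) ((hφ m).differentiable X)]
        simp] at h2
    calc _ ≤ _ := add_le_add h1 (mul_le_mul' le_rfl h2)
      _ = _ := by simp only [he]; ring
  obtain ⟨u, hu, hlim⟩ : ∃ u : (𝔼 N) → ℝ, MemLp u 2 (volume.restrict D) ∧
      Tendsto (fun n => eLpNorm (fun x => φ n (x, 0) - u x) 2 (volume.restrict D))
        atTop (𝓝 0) := by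
    have hcs : CauchySeq fun n => (hum n).toLp _ := by
      rw [Lp.cauchySeq_Lp_iff_cauchySeq_eLpNorm, ← prod_atTop_atTop_eq]
      have h2 : Tendsto (fun p : ℕ × ℕ => e p.1 + e p.2) (atTop ×ˢ atTop) (𝓝 0) := by
        simpa using (he0.comp tendsto_fst).add (he0.comp tendsto_snd)
      refine tendsto_of_tendsto_of_tendsto_of_le_of_le tendsto_const_nhds h2
        (fun _ => zero_le) fun p => ?_
      refine le_trans (le_of_eq (eLpNorm_congr_ae ?_)) (hcauchy p.1 p.2)
      exact (hum p.1).coeFn_toLp.sub (hum p.2).coeFn_toLp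
    obtain ⟨v, hv⟩ := cauchySeq_tendsto_of_complete hcs
    refine ⟨v, Lp.memLp v, ?_⟩
    rw [← Lp.toLp_coeFn v (Lp.memLp v), Lp.tendsto_Lp_iff_tendsto_eLpNorm''] at hv
    exact hv
  refine ⟨u, ⟨hu, ?_⟩, hlim⟩
  -- `n → ∞` at fixed `ε`: the factor `ε⁻¹` is compensated by the width of the strip
  have hbound : ∀ ε : ℝ, 0 < ε → ENNReal.ofReal ε⁻¹ *
      ∫⁻ X in D ×ˢ Ioo (0 : ℝ) ε, ‖w X - u X.1‖ₑ ^ 2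
      ≤ ENNReal.ofReal (ε ^ (2 * α) / (2 * α)) * eLpNorm Gy 2 (weightedMeasure α D) ^ 2 := by
    intro ε hε
    have hsub : D ×ˢ Ioo 0 ε ⊆ cylinder D := Set.prod_mono le_rfl Ioo_subset_Ioi_self
    set ν := volume.restrict (D ×ˢ Ioo 0 ε) with hν
    have hwν : AEStronglyMeasurable w ν := hwm.mono_measure (Measure.restrict_mono hsub le_rfl)
    have huν : AEStronglyMeasurable (fun X : (𝔼 N) × ℝ => u X.1) ν := by
      rw [hν, restrict_prod_Ioo]; exact hu.1.comp_fst
    set d : ℝ≥0∞ := (ENNReal.ofReal ε * ENNReal.ofReal (ε ^ (2 * α) / (2 * α))) ^ (1 / 2 : ℝ)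
      with hd
    have hd' : d ≠ ⊤ := ENNReal.rpow_ne_top_of_nonneg (by norm_num)
      (ENNReal.mul_ne_top (by simp) (by simp))
    set r : ℝ≥0∞ := ENNReal.ofReal ε ^ (1 / 2 : ℝ) with hr
    have hr' : r ≠ ⊤ := ENNReal.rpow_ne_top_of_nonneg (by norm_num) (by simp)
    have hn (n : ℕ) : eLpNorm (fun X => w X - u X.1) 2 ν
        ≤ eLpNorm (fun X => φ n X - w X) 2 (volume.restrict (cylinder D)) +
          d * (eLpNorm (fun X => derivY (φ n) X - Gy X) 2 (weightedMeasure α D) +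
            eLpNorm Gy 2 (weightedMeasure α D)) +
          r * eLpNorm (fun x => φ n (x, 0) - u x) 2 (volume.restrict D) := by
      have h1 : eLpNorm (w - φ n) 2 ν
          ≤ eLpNorm (fun X => φ n X - w X) 2 (volume.restrict (cylinder D)) := by
        rw [eLpNorm_sub_comm]
        exact eLpNorm_mono_measure _ (Measure.restrict_mono hsub le_rfl)
      have h2 : eLpNorm (fun X : (𝔼 N) × ℝ => φ n X - φ n (X.1, 0)) 2 ν
          ≤ d * (eLpNorm (fun X => derivY (φ n) X - Gy X) 2 (weightedMeasure α D) +
            eLpNorm Gy 2 (weightedMeasure α D)) := by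
        have h3 : eLpNorm (fun X : (𝔼 N) × ℝ => φ n X - φ n (X.1, 0)) 2 ν
            ≤ d * eLpNorm (derivY (φ n)) 2 (weightedMeasure α D) := by
          rw [← sq_le_sq_ennreal, mul_pow, hd, rpow_half_sq]
          exact (hφ n).eLpNorm_sub_boundary_le hα D ε
        refine h3.trans (mul_le_mul' le_rfl ?_)
        have := eLpNorm_add_le (f := fun X => derivY (φ n) X - Gy X) (g := Gy) (p := 2)
          (μ := weightedMeasure α D) ((hφ n).continuous_derivY.aestronglyMeasurable.sub hGm) hGm
          (by norm_num)
        rwa [show (fun X => derivY (φ n) X - Gy X) + Gy = derivY (φ n) by ext X; simp] at this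
      have h4 : eLpNorm (fun X : (𝔼 N) × ℝ => φ n (X.1, 0) - u X.1) 2 ν
          ≤ r * eLpNorm (fun x => φ n (x, 0) - u x) 2 (volume.restrict D) := by
        rw [← sq_le_sq_ennreal, mul_pow, hr, rpow_half_sq]
        exact (eLpNorm_comp_fst_restrict_Ioo D (v := fun x => φ n (x, 0) - u x)
          ((hum n).1.sub hu.1) ε).le
      have h5 := eLpNorm_add_le (f := (w - φ n) + fun X : (𝔼 N) × ℝ => φ n X - φ n (X.1, 0))
        (g := fun X => φ n (X.1, 0) - u X.1) (p := 2) (μ := ν)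
        ((hwν.sub (by fun_prop)).add (by fun_prop))
        (AEStronglyMeasurable.sub (by fun_prop) huν) (by norm_num)
      have h6 := eLpNorm_add_le (f := w - φ n) (g := fun X : (𝔼 N) × ℝ => φ n X - φ n (X.1, 0))
        (p := 2) (μ := ν) (hwν.sub (by fun_prop)) (by fun_prop) (by norm_num)
      rw [show (w - φ n) + (fun X : (𝔼 N) × ℝ => φ n X - φ n (X.1, 0)) +
        (fun X => φ n (X.1, 0) - u X.1) = fun X => w X - u X.1 by ext X; simp] at h5
      exact h5.trans (add_le_add (h6.trans (add_le_add h1 h2)) h4)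
    have hR := (hφw.add (ENNReal.Tendsto.const_mul (hφG.add_const
      (eLpNorm Gy 2 (weightedMeasure α D))) (Or.inr hd'))).add
      (ENNReal.Tendsto.const_mul hlim (Or.inr hr'))
    have hle := ge_of_tendsto' hR hn
    simp only [zero_add, mul_zero, add_zero] at hle
    rw [← sq_le_sq_ennreal, mul_pow, hd, rpow_half_sq, eLpNorm_two_sq] at hle
    have hcancel : ENNReal.ofReal ε⁻¹ * ENNReal.ofReal ε = 1 := by
      rw [← ENNReal.ofReal_mul (by positivity), inv_mul_cancel₀ hε.ne', ENNReal.ofReal_one]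
    calc _ ≤ _ := mul_le_mul' le_rfl hle
      _ = _ := by rw [← mul_assoc, ← mul_assoc, hcancel, one_mul]
  have hz : Tendsto (fun ε : ℝ => ENNReal.ofReal (ε ^ (2 * α) / (2 * α)) *
      eLpNorm Gy 2 (weightedMeasure α D) ^ 2) (𝓝[>] 0) (𝓝 0) := by
    have h1 : Tendsto (fun ε : ℝ => ε ^ (2 * α) / (2 * α)) (𝓝[>] 0) (𝓝 0) := by
      have : ContinuousAt (fun ε : ℝ => ε ^ (2 * α) / (2 * α)) 0 :=
        (Real.continuousAt_rpow_const _ _ (Or.inr (by linarith))).div_const _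
      have h := this.tendsto.mono_left (nhdsWithin_le_nhds (s := Ioi 0))
      rwa [Real.zero_rpow (by linarith), zero_div] at h
    have h2 := ENNReal.Tendsto.mul_const (b := eLpNorm Gy 2 (weightedMeasure α D) ^ 2)
      (ENNReal.tendsto_ofReal h1) (Or.inr (ENNReal.pow_ne_top hGy.2.ne))
    simpa using h2
  exact tendsto_of_tendsto_of_tendsto_of_le_of_le' tendsto_const_nhds hz
    (Eventually.of_forall fun _ => zero_le) (eventually_mem_nhdsWithin.mono fun ε hε => hbound ε hε)

/-! ### From level-set estimates to norm estimates -/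

/-- Layer cake formula for `v / 2`. The power `κ` of the mass of `f` on `{v > s}` is split into one
factor that is integrated in `s`, and `κ - 1` factors bounded by Markov's inequality. -/
theorem lintegral_rpow_le_of_level_estimate {Ω : Type*} [MeasurableSpace Ω] {μ : Measure Ω}
    [SFinite μ] {κ m : ℝ} (hκ : 1 ≤ κ) (hm : 0 < m) {v : Ω → ℝ} (hv0 : ∀ x, 0 ≤ v x)
    (hv : AEMeasurable v μ) {f : Ω → ℝ≥0∞} (hf : AEMeasurable f μ) {c : ℝ≥0}
    (hlevel : ∀ s : ℝ, 0 < s →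
      ENNReal.ofReal s * μ {x | 2 * s < v x} ^ (1 / κ) ≤ c * ∫⁻ x in {x | s < v x}, f x ∂μ) :
    ENNReal.ofReal m * ∫⁻ x, ENNReal.ofReal ((v x / 2) ^ (κ * (m + 1))) ∂μ
      ≤ ENNReal.ofReal (κ * (m + 1)) * c ^ κ *
        (∫⁻ x, f x * ENNReal.ofReal (v x ^ m) ∂μ) ^ κ := by
  have hκ0 : 0 < κ := by linarith
  set q := κ * (m + 1) with hq
  have hq0 : 0 < q := by positivity
  set ν := μ.withDensity f with hν
  have hνμ : ν ≪ μ := withDensity_absolutelyContinuous μ f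
  set F : ℝ → ℝ≥0∞ := fun s => ν {x | s < v x} with hF
  set Y := ∫⁻ x, f x * ENNReal.ofReal (v x ^ m) ∂μ with hY
  have hvm : AEMeasurable (fun x => ENNReal.ofReal (v x ^ m)) μ := by fun_prop
  have hYν : Y = ∫⁻ x, ENNReal.ofReal (v x ^ m) ∂ν := by
    rw [hν, lintegral_withDensity_eq_lintegral_mul₀ hf hvm]; rfl
  have hYlayer : Y = ENNReal.ofReal m * ∫⁻ s in Ioi 0, F s * ENNReal.ofReal (s ^ (m - 1)) := by
    rw [hYν, lintegral_rpow_eq_lintegral_meas_lt_mul ν (ae_of_all _ hv0) (hv.mono_ac hνμ) hm]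
  have hmarkov (s : ℝ) (hs : 0 < s) : ENNReal.ofReal (s ^ m) * F s ≤ Y := by
    rw [hYν]
    refine le_trans (mul_le_mul' le_rfl (measure_mono fun x hx => ?_))
      (mul_meas_ge_le_lintegral₀ (hvm.mono_ac hνμ) _)
    exact ENNReal.ofReal_le_ofReal (Real.rpow_le_rpow hs.le (le_of_lt hx) hm.le)
  have hpoint (s : ℝ) (hs : 0 < s) : μ {x | s < v x / 2} * ENNReal.ofReal (s ^ (q - 1))
      ≤ c ^ κ * Y ^ (κ - 1) * (F s * ENNReal.ofReal (s ^ (m - 1))) := by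
    have hset : {x | s < v x / 2} = {x | 2 * s < v x} := by
      ext x; rw [mem_ofPred_eq, mem_ofPred_eq]; constructor <;> intro h <;> linarith
    have h1 := hlevel s hs
    rw [← withDensity_apply' f, ← hset] at h1
    have hs0 : ENNReal.ofReal s ≠ 0 := by simpa using hs
    have h2 : ENNReal.ofReal (s ^ κ) * μ {x | s < v x / 2} ≤ c ^ κ * F s ^ κ := by
      have := ENNReal.rpow_le_rpow h1 hκ0.le
      rwa [ENNReal.mul_rpow_of_nonneg _ _ hκ0.le, ENNReal.mul_rpow_of_nonneg _ _ hκ0.le,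
        ← ENNReal.rpow_mul, one_div_mul_cancel hκ0.ne', ENNReal.rpow_one,
        ENNReal.ofReal_rpow_of_pos hs] at this
    have e1 : ENNReal.ofReal (s ^ (q - 1)) = ENNReal.ofReal (s ^ κ) *
        (ENNReal.ofReal (s ^ m) ^ (κ - 1) * ENNReal.ofReal (s ^ (m - 1))) := by
      rw [ENNReal.ofReal_rpow_of_pos (by positivity), ← ENNReal.ofReal_mul (by positivity),
        ← ENNReal.ofReal_mul (by positivity), ← Real.rpow_mul hs.le, ← Real.rpow_add hs,
        ← Real.rpow_add hs]
      congr 2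
      rw [hq]; ring
    have e2 : F s ^ κ = F s ^ (κ - 1) * F s := by
      conv_rhs => rw [← ENNReal.rpow_one (F s), ← ENNReal.rpow_mul, one_mul]
      rw [← ENNReal.rpow_add_of_nonneg _ _ (by linarith) zero_le_one, sub_add_cancel]
    calc μ {x | s < v x / 2} * ENNReal.ofReal (s ^ (q - 1))
        = ENNReal.ofReal (s ^ κ) * μ {x | s < v x / 2} *
          (ENNReal.ofReal (s ^ m) ^ (κ - 1) * ENNReal.ofReal (s ^ (m - 1))) := by rw [e1]; ring
      _ ≤ c ^ κ * F s ^ κ *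
          (ENNReal.ofReal (s ^ m) ^ (κ - 1) * ENNReal.ofReal (s ^ (m - 1))) :=
          mul_le_mul' h2 le_rfl
      _ = c ^ κ * (ENNReal.ofReal (s ^ m) * F s) ^ (κ - 1) *
          (F s * ENNReal.ofReal (s ^ (m - 1))) := by
          rw [e2, ENNReal.mul_rpow_of_nonneg _ _ (by linarith)]; ring
      _ ≤ _ := by
          refine mul_le_mul' (mul_le_mul' le_rfl ?_) le_rfl
          exact ENNReal.rpow_le_rpow (hmarkov s hs) (by linarith)
  have hFm : Measurable F :=
    (show Antitone F from fun a b hab => measure_mono fun x (hx : b < v x) =>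
      lt_of_le_of_lt hab hx).measurable
  have e3 : Y ^ κ = Y ^ (κ - 1) * Y := by
    conv_rhs => rw [← ENNReal.rpow_one Y, ← ENNReal.rpow_mul, one_mul]
    rw [← ENNReal.rpow_add_of_nonneg _ _ (by linarith) zero_le_one, sub_add_cancel]
  rw [lintegral_rpow_eq_lintegral_meas_lt_mul μ (ae_of_all _ fun x => by
    have := hv0 x; positivity) (hv.div_const 2) hq0]
  calc _ ≤ ENNReal.ofReal m * (ENNReal.ofReal q * ∫⁻ s in Ioi 0,
        c ^ κ * Y ^ (κ - 1) * (F s * ENNReal.ofReal (s ^ (m - 1)))) := by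
        refine mul_le_mul' le_rfl (mul_le_mul' le_rfl ?_)
        exact setLIntegral_mono' measurableSet_Ioi fun s hs => hpoint s hs
    _ = ENNReal.ofReal q * c ^ κ * (Y ^ (κ - 1) *
        (ENNReal.ofReal m * ∫⁻ s in Ioi 0, F s * ENNReal.ofReal (s ^ (m - 1)))) := by
        rw [lintegral_const_mul _ (by fun_prop)]; ring
    _ = _ := by rw [← hYlayer, e3]

/-- The nonlinear estimate closed by Hölder's inequality and absorption. Boundedness of `v` makes
the absorbed quantity finite. -/
theorem lintegral_rpow_le_of_level_estimate_of_bdd {Ω : Type*} [MeasurableSpace Ω] {μ : Measure Ω}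
    [IsFiniteMeasure μ] {κ m p : ℝ} (hκ : 1 ≤ κ) (hm : 0 < m)
    (hp : p.HolderConjugate (κ * (m + 1) / m)) {v : Ω → ℝ} (hv0 : ∀ x, 0 ≤ v x)
    (hv : AEMeasurable v μ) {b : ℝ} (hvb : ∀ x, v x ≤ b) {f : Ω → ℝ≥0∞} (hf : AEMeasurable f μ)
    {c : ℝ≥0} (hlevel : ∀ s : ℝ, 0 < s →
      ENNReal.ofReal s * μ {x | 2 * s < v x} ^ (1 / κ) ≤ c * ∫⁻ x in {x | s < v x}, f x ∂μ) :
    (∫⁻ x, ENNReal.ofReal (v x ^ (κ * (m + 1))) ∂μ) ^ (1 / (κ * (m + 1)))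
      ≤ ENNReal.ofReal (2 ^ (κ * (m + 1)) * (κ * (m + 1)) * c ^ κ / m) ^ (1 / κ) *
        (∫⁻ x, f x ^ p ∂μ) ^ (1 / p) := by
  have hκ0 : 0 < κ := by linarith
  have h1 := lintegral_rpow_le_of_level_estimate hκ hm hv0 hv hf hlevel
  set q := κ * (m + 1) with hq
  have hq0 : 0 < q := by positivity
  set X := ∫⁻ x, ENNReal.ofReal (v x ^ q) ∂μ with hX
  set Φ := (∫⁻ x, f x ^ p ∂μ) ^ (1 / p) with hΦ
  set C := ENNReal.ofReal (2 ^ q * q * c ^ κ / m) with hC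
  have hXtop : X ≠ ⊤ := by
    refine ne_top_of_le_ne_top (b := ENNReal.ofReal (b ^ q) * μ univ)
      (ENNReal.mul_ne_top (by simp) (measure_ne_top _ _)) ?_
    rw [← lintegral_const]
    exact lintegral_mono fun x =>
      ENNReal.ofReal_le_ofReal (Real.rpow_le_rpow (hv0 x) (hvb x) hq0.le)
  rcases eq_or_ne X 0 with hX0 | hX0
  · rw [hX0, ENNReal.zero_rpow_of_pos (by positivity)]; exact zero_le
  have hY : ∫⁻ x, f x * ENNReal.ofReal (v x ^ m) ∂μ ≤ Φ * X ^ (m / q) := by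
    refine (ENNReal.lintegral_mul_le_Lp_mul_Lq μ hp hf
      (g := fun x => ENNReal.ofReal (v x ^ m)) (by fun_prop)).trans (le_of_eq ?_)
    rw [one_div_div]
    congr 3
    ext x
    rw [ENNReal.ofReal_rpow_of_nonneg (Real.rpow_nonneg (hv0 x) _) (by positivity),
      ← Real.rpow_mul (hv0 x), mul_div_cancel₀ _ hm.ne']
  have h2 : ENNReal.ofReal (2 ^ q) * ∫⁻ x, ENNReal.ofReal ((v x / 2) ^ q) ∂μ = X := by
    rw [← lintegral_const_mul' _ _ (by simp)]
    refine lintegral_congr fun x => ?_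
    have := hv0 x
    rw [← ENNReal.ofReal_mul (by positivity), ← Real.mul_rpow (by norm_num) (by positivity)]
    congr 2; ring
  have hm' : ENNReal.ofReal m ≠ 0 := by simpa using hm
  have h3 : X ≤ C * (Φ * X ^ (m / q)) ^ κ := by
    have h4 : ENNReal.ofReal m * X ≤ ENNReal.ofReal m * (C * (Φ * X ^ (m / q)) ^ κ) := by
      have e : ENNReal.ofReal m * C = ENNReal.ofReal (2 ^ q) * (ENNReal.ofReal q * c ^ κ) := by
        rw [hC, ← ENNReal.ofReal_coe_nnreal, ENNReal.ofReal_rpow_of_nonneg (by simp) hκ0.le,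
          ← ENNReal.ofReal_mul hm.le, ← ENNReal.ofReal_mul hq0.le,
          ← ENNReal.ofReal_mul (by positivity)]
        congr 1; field_simp
      calc ENNReal.ofReal m * X = ENNReal.ofReal (2 ^ q) *
            (ENNReal.ofReal m * ∫⁻ x, ENNReal.ofReal ((v x / 2) ^ q) ∂μ) := by
            rw [← h2]; ring
        _ ≤ ENNReal.ofReal (2 ^ q) * (ENNReal.ofReal q * c ^ κ * (Φ * X ^ (m / q)) ^ κ) := by
            refine mul_le_mul' le_rfl (h1.trans (mul_le_mul' le_rfl ?_))
            exact ENNReal.rpow_le_rpow hY hκ0.le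
        _ = _ := by rw [← mul_assoc (ENNReal.ofReal m), e]; ring
    exact (ENNReal.mul_le_mul_iff_right hm' (by simp)).1 h4
  have hexp : m / q * κ = m / (m + 1) := by rw [hq]; field_simp
  have h5 : X ^ (κ / q) ≤ C * Φ ^ κ := by
    rw [ENNReal.mul_rpow_of_nonneg _ _ hκ0.le, ← ENNReal.rpow_mul X, hexp, ← mul_assoc] at h3
    have e : X ^ (κ / q) * X ^ (m / (m + 1)) = X := by
      rw [← ENNReal.rpow_add _ _ hX0 hXtop]
      conv_rhs => rw [← ENNReal.rpow_one X]
      congr 1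
      rw [hq]; field_simp; ring
    refine (ENNReal.mul_le_mul_iff_left (c := X ^ (m / (m + 1))) ?_ ?_).1 (by rwa [e])
    · simp [hX0, hXtop]
    · exact ENNReal.rpow_ne_top_of_nonneg (by positivity) hXtop
  have h6 := ENNReal.rpow_le_rpow h5 (z := 1 / κ) (by positivity)
  rw [← ENNReal.rpow_mul, ENNReal.mul_rpow_of_nonneg _ _ (by positivity), ← ENNReal.rpow_mul Φ,
    mul_one_div_cancel hκ0.ne', ENNReal.rpow_one] at h6
  convert h6 using 2
  field_simp

/-- Strong-type bound from level-set estimates: if the measure of `{|u| > 2s}` is controlled by the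
mass of `f` on `{|u| > s}`, at every height `s`, then `u ∈ L^q` with the norm bounded by that of
`f` in `L^p`, where `1 / p + m / q = 1` and `q = κ (m + 1)`. -/
theorem eLpNorm_le_of_level_estimate {Ω : Type*} [MeasurableSpace Ω] {μ : Measure Ω}
    [IsFiniteMeasure μ] {κ m p : ℝ} (hκ : 1 ≤ κ) (hm : 0 < m)
    (hp : p.HolderConjugate (κ * (m + 1) / m)) {u f : Ω → ℝ}
    (hu : AEStronglyMeasurable u μ) (hf : AEStronglyMeasurable f μ)
    {c : ℝ≥0} (hlevel : ∀ s : ℝ, 0 < s →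
      ENNReal.ofReal s * μ {x | 2 * s < |u x|} ^ (1 / κ)
        ≤ c * ∫⁻ x in {x | s < |u x|}, ‖f x‖ₑ ∂μ) :
    eLpNorm u (ENNReal.ofReal (κ * (m + 1))) μ
      ≤ ENNReal.ofReal (2 ^ (κ * (m + 1)) * (κ * (m + 1)) * c ^ κ / m) ^ (1 / κ) *
        eLpNorm f (ENNReal.ofReal p) μ := by
  have hκ0 : 0 < κ := by linarith
  set q := κ * (m + 1) with hq
  have hq0 : 0 < q := by positivity
  have hp0 : 0 < p := hp.pos
  rw [eLpNorm_eq_lintegral_rpow_enorm_toReal (by simpa using hq0) (by simp),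
    eLpNorm_eq_lintegral_rpow_enorm_toReal (by simpa using hp0) (by simp),
    ENNReal.toReal_ofReal hq0.le, ENNReal.toReal_ofReal hp0.le]
  have hum : AEMeasurable (fun x => |u x|) μ := by
    simpa only [← Real.norm_eq_abs] using hu.norm.aemeasurable
  -- cutting off at height `n` preserves the level estimates: those at `2 s ≥ n` become trivial
  have hbd (n : ℕ) : (∫⁻ x, ENNReal.ofReal (min |u x| n ^ q) ∂μ) ^ (1 / q)
      ≤ ENNReal.ofReal (2 ^ q * q * c ^ κ / m) ^ (1 / κ) *
        (∫⁻ x, ‖f x‖ₑ ^ p ∂μ) ^ (1 / p) := by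
    refine lintegral_rpow_le_of_level_estimate_of_bdd hκ hm hp (fun x => by positivity)
      (hum.min aemeasurable_const) (b := n) (fun x => min_le_right _ _) hf.enorm
      fun s hs => ?_
    rcases lt_or_ge (2 * s) n with hn | hn
    · have hs' : s < n := by linarith
      simpa [lt_min_iff, hn, hs'] using hlevel s hs
    · have : {x | 2 * s < min |u x| n} = ∅ := by
        ext x; simp [hn]
      rw [this, measure_empty, ENNReal.zero_rpow_of_pos (by positivity), mul_zero]
      exact zero_le
  have hlim : Tendsto (fun n : ℕ => ∫⁻ x, ENNReal.ofReal (min |u x| n ^ q) ∂μ) atTop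
      (𝓝 (∫⁻ x, ‖u x‖ₑ ^ q ∂μ)) := by
    refine lintegral_tendsto_of_tendsto_of_monotone
      (fun n => by fun_prop) (ae_of_all _ fun x a b hab => ?_) (ae_of_all _ fun x => ?_)
    · refine ENNReal.ofReal_le_ofReal (Real.rpow_le_rpow (by positivity) ?_ hq0.le)
      exact min_le_min le_rfl (by exact_mod_cast hab)
    · obtain ⟨n₀, hn₀⟩ := exists_nat_ge |u x|
      refine tendsto_const_nhds.congr' ((eventually_ge_atTop n₀).mono fun n hn => ?_)
      dsimp only
      rw [min_eq_left (hn₀.trans (Nat.cast_le.2 hn)),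
        ← ENNReal.ofReal_rpow_of_nonneg (abs_nonneg _) hq0.le, ← Real.enorm_eq_ofReal_abs]
  exact le_of_tendsto' ((ENNReal.continuous_rpow_const.tendsto _).comp hlim) hbd

/-! ### Truncations of the solution -/

/-- A smooth odd truncation: it ignores the values in `[-s, s]`, saturates at `±s` outside
`(-2s, 2s)`, and its slope lies in `[0, L]`. -/
structure IsTruncation (L : ℝ≥0) (s : ℝ) (G : ℝ → ℝ) : Prop where
  smooth : ContDiff ℝ ∞ G
  deriv_nonneg : ∀ t, 0 ≤ deriv G t
  deriv_le : ∀ t, deriv G t ≤ L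
  abs_le : ∀ t, |G t| ≤ s
  eq_zero : ∀ t, |t| ≤ s → G t = 0
  abs_eq : ∀ t, 2 * s ≤ |t| → |G t| = s

/-- The slope bound does not depend on the height, by scaling. -/
theorem exists_isTruncation : ∃ L : ℝ≥0, ∀ s : ℝ, 0 < s → ∃ G, IsTruncation L s G := by
  set H : ℝ → ℝ := fun t => Real.smoothTransition (t - 1) - Real.smoothTransition (-t - 1) with hH
  have hsm : ContDiff ℝ ∞ H :=
    (Real.smoothTransition.contDiff.comp (by fun_prop)).sub
      (Real.smoothTransition.contDiff.comp (by fun_prop))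
  have hmono : Monotone H := fun a b hab =>
    sub_le_sub (Real.smoothTransition.monotone (by linarith))
      (Real.smoothTransition.monotone (by linarith))
  have hge (t : ℝ) (ht : 2 ≤ t) : H t = 1 := by
    simp [hH, Real.smoothTransition.one_of_one_le (show 1 ≤ t - 1 by linarith),
      Real.smoothTransition.zero_of_nonpos (show -t - 1 ≤ 0 by linarith)]
  have hle (t : ℝ) (ht : t ≤ -2) : H t = -1 := by
    simp [hH, Real.smoothTransition.one_of_one_le (show 1 ≤ -t - 1 by linarith),
      Real.smoothTransition.zero_of_nonpos (show t - 1 ≤ 0 by linarith)]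
  obtain ⟨B, hB⟩ := (isCompact_Icc (a := (-2 : ℝ)) (b := 2)).exists_bound_of_continuousOn
    (hsm.continuous_deriv (by simp)).continuousOn
  have hderiv (t : ℝ) : deriv H t ≤ B.toNNReal := by
    by_cases ht : t ∈ Icc (-2 : ℝ) 2
    · exact (le_abs_self _).trans ((hB t ht).trans (Real.le_coe_toNNReal B))
    · have : deriv H t = 0 := by
        rw [mem_Icc, not_and_or, not_le, not_le] at ht
        rcases ht with ht | ht
        · have : H =ᶠ[𝓝 t] fun _ => -1 :=
            (eventually_lt_nhds ht).mono fun x hx => hle x hx.le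
          rw [this.deriv_eq, deriv_const]
        · have : H =ᶠ[𝓝 t] fun _ => 1 :=
            (eventually_gt_nhds ht).mono fun x hx => hge x hx.le
          rw [this.deriv_eq, deriv_const]
      rw [this]; exact NNReal.coe_nonneg _
  have habs (t : ℝ) : |H t| ≤ 1 := by
    have := Real.smoothTransition.nonneg (t - 1)
    have := Real.smoothTransition.nonneg (-t - 1)
    have := Real.smoothTransition.le_one (t - 1)
    have := Real.smoothTransition.le_one (-t - 1)
    rw [abs_le]; constructor <;> simp only [hH] <;> linarith
  refine ⟨B.toNNReal, fun s hs => ⟨fun t => s * H (t / s), ?_⟩⟩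
  have hd (t : ℝ) : deriv (fun t => s * H (t / s)) t = deriv H (t / s) := by
    have h1 : HasDerivAt H (deriv H (t / s)) (t / s) :=
      (hsm.differentiable (by simp) _).hasDerivAt
    have h2 := (h1.comp t ((hasDerivAt_id t).div_const s)).const_mul s
    have h3 := h2.deriv
    rw [show s * (deriv H (t / s) * (1 / s)) = deriv H (t / s) by field_simp] at h3
    exact h3
  refine ⟨contDiff_const.mul (hsm.comp (by fun_prop)), fun t => ?_, fun t => ?_, fun t => ?_,
    fun t ht => ?_, fun t ht => ?_⟩
  · rw [hd]; exact hmono.deriv_nonneg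
  · rw [hd]; exact hderiv _
  · rw [abs_mul, abs_of_pos hs]; exact mul_le_of_le_one_right hs.le (habs _)
  · have ht' := abs_le.1 ht
    have h1 : t / s ≤ 1 := by rw [div_le_one hs]; exact ht'.2
    have h2 : -1 ≤ t / s := by rw [le_div_iff₀ hs]; linarith [ht'.1]
    simp [hH, Real.smoothTransition.zero_of_nonpos (show t / s - 1 ≤ 0 by linarith),
      Real.smoothTransition.zero_of_nonpos (show -(t / s) - 1 ≤ 0 by linarith)]
  · rw [abs_mul, abs_of_pos hs]
    rcases le_abs.1 ht with h | h
    · rw [hge _ (by rw [le_div_iff₀ hs]; exact h)]; simp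
    · rw [hle _ (by rw [div_le_iff₀ hs]; linarith)]; simp

theorem lintegral_enorm_mul_enorm_le {Ω F : Type*} [MeasurableSpace Ω] [NormedAddCommGroup F]
    {μ : Measure Ω} {g h : Ω → F} (hg : AEStronglyMeasurable g μ) (hh : AEStronglyMeasurable h μ) :
    ∫⁻ x, ‖g x‖ₑ * ‖h x‖ₑ ∂μ ≤ eLpNorm g 2 μ * eLpNorm h 2 μ := by
  have := ENNReal.lintegral_mul_le_Lp_mul_Lq μ Real.HolderConjugate.two_two hg.enorm hh.enorm
  rw [eLpNorm_eq_lintegral_rpow_enorm_toReal (by simp) (by simp),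
    eLpNorm_eq_lintegral_rpow_enorm_toReal (by simp) (by simp)]
  simpa using this

theorem integrable_norm_mul_norm {Ω F : Type*} [MeasurableSpace Ω] [NormedAddCommGroup F]
    {μ : Measure Ω} {g h : Ω → F} (hg : MemLp g 2 μ) (hh : MemLp h 2 μ) :
    Integrable (fun x => ‖g x‖ * ‖h x‖) μ :=
  hg.norm.integrable_mul hh.norm

/-- Testing the equation with `G (φ)`, where `φ` is a test function close to the solution: the
energy of `G (φ)` is bounded by the boundary term and by the distance from `φ` to the solution. -/
theorem energy_truncation_le {α : ℝ} {D : Set (𝔼 N)} {f : (𝔼 N) → ℝ}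
    {Gx : (𝔼 N) × ℝ → 𝔼 N} {Gy : (𝔼 N) × ℝ → ℝ}
    (hGx : MemLp Gx 2 (weightedMeasure α D)) (hGy : MemLp Gy 2 (weightedMeasure α D))
    (hweak : ∀ φ, IsTestFunction (D ×ˢ (univ : Set ℝ)) φ →
      ∫ X, (inner ℝ (Gx X) (gradX φ X) + Gy X * derivY φ X) ∂(weightedMeasure α D)
        = ∫ x in D, f x * φ (x, 0))
    {L : ℝ≥0} {s : ℝ} (hs : 0 < s) {G : ℝ → ℝ} (hG : IsTruncation L s G) {φ : (𝔼 N) × ℝ → ℝ}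
    (hφ : IsTestFunction (D ×ˢ univ) φ) (hx : MemLp (gradX φ) 2 (weightedMeasure α D))
    (hy : MemLp (derivY φ) 2 (weightedMeasure α D)) :
    energy α D (fun X => G (φ X)) ≤ ENNReal.ofReal (L * ∫ x in D, f x * G (φ (x, 0))) +
      L ^ 2 * (eLpNorm (fun X => gradX φ X - Gx X) 2 (weightedMeasure α D) *
          eLpNorm (gradX φ) 2 (weightedMeasure α D) +
        eLpNorm (fun X => derivY φ X - Gy X) 2 (weightedMeasure α D) *
          eLpNorm (derivY φ) 2 (weightedMeasure α D)) := by
  set μ := weightedMeasure α D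
  have hG0 : G 0 = 0 := hG.eq_zero 0 (by simpa using hs.le)
  have hdG : Differentiable ℝ G := hG.smooth.differentiable (by simp)
  have hgx (X) : gradX (fun Z => G (φ Z)) X = deriv G (φ X) • gradX φ X :=
    gradX_comp (hφ.differentiable X) (hdG _)
  have hgy (X) : derivY (fun Z => G (φ Z)) X = deriv G (φ X) * derivY φ X :=
    derivY_comp (hφ.differentiable X) (hdG _)
  have hw := hweak _ (hφ.comp hG.smooth hG0)
  simp only [hgx, hgy] at hw
  have hgm : Continuous fun X => deriv G (φ X) :=
    (hG.smooth.continuous_deriv (by simp)).comp hφ.continuous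
  have hLn : (0 : ℝ) ≤ L := L.coe_nonneg
  have hgn (X) : ‖deriv G (φ X)‖ ≤ L := by
    rw [Real.norm_eq_abs, abs_of_nonneg (hG.deriv_nonneg _)]; exact hG.deriv_le _
  have hcx := hφ.continuous_gradX
  have hcy := hφ.continuous_derivY
  have hGxm := hGx.1
  have hGym := hGy.1
  have hI1 : Integrable (fun X => inner ℝ (Gx X) (deriv G (φ X) • gradX φ X)
      + Gy X * (deriv G (φ X) * derivY φ X)) μ := by
    refine Integrable.mono' (((integrable_norm_mul_norm hGx hx).add
      (integrable_norm_mul_norm hGy hy)).const_mul (L : ℝ)) ?_ (ae_of_all _ fun X => ?_)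
    · exact (hGxm.inner (by fun_prop)).add (hGym.mul (by fun_prop))
    · refine (norm_add_le _ _).trans ?_
      simp only [Pi.add_apply, mul_add]
      refine add_le_add ?_ ?_
      · refine (norm_inner_le_norm _ _).trans ?_
        rw [norm_smul, mul_left_comm]
        gcongr
        exact hgn X
      · rw [norm_mul, norm_mul, mul_left_comm]
        gcongr
        exact hgn X
  have hJx : Integrable (fun X => ‖gradX φ X - Gx X‖ * ‖gradX φ X‖) μ :=
    integrable_norm_mul_norm (hx.sub hGx) hx
  have hJy : Integrable (fun X => ‖derivY φ X - Gy X‖ * ‖derivY φ X‖) μ :=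
    integrable_norm_mul_norm (hy.sub hGy) hy
  have hI2 : Integrable (fun X => (L : ℝ) ^ 2 * (‖gradX φ X - Gx X‖ * ‖gradX φ X‖ +
      ‖derivY φ X - Gy X‖ * ‖derivY φ X‖)) μ := (hJx.add hJy).const_mul _
  have hpt (X) : ‖deriv G (φ X) • gradX φ X‖ ^ 2 + ‖deriv G (φ X) * derivY φ X‖ ^ 2
      ≤ L * (inner ℝ (Gx X) (deriv G (φ X) • gradX φ X) + Gy X * (deriv G (φ X) * derivY φ X)) +
        L ^ 2 * (‖gradX φ X - Gx X‖ * ‖gradX φ X‖ + ‖derivY φ X - Gy X‖ * ‖derivY φ X‖) := by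
    have h0 := hG.deriv_nonneg (φ X)
    have h1 := hG.deriv_le (φ X)
    set g := deriv G (φ X)
    set a := gradX φ X
    set b := derivY φ X
    rw [norm_smul, norm_mul, inner_smul_right, mul_pow, mul_pow, Real.norm_eq_abs g, sq_abs]
    have e1 : inner ℝ (a - Gx X) a = ‖a‖ ^ 2 - inner ℝ (Gx X) a := by
      rw [inner_sub_left, real_inner_self_eq_norm_sq]
    have e2 : (b - Gy X) * b = ‖b‖ ^ 2 - Gy X * b := by
      rw [Real.norm_eq_abs, sq_abs]; ring
    have i1 : inner ℝ (a - Gx X) a ≤ ‖a - Gx X‖ * ‖a‖ := real_inner_le_norm _ _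
    have i2 : (b - Gy X) * b ≤ ‖b - Gy X‖ * ‖b‖ := by
      rw [← norm_mul]; exact le_abs_self _
    have hP : 0 ≤ ‖a - Gx X‖ * ‖a‖ + ‖b - Gy X‖ * ‖b‖ := by positivity
    calc g ^ 2 * ‖a‖ ^ 2 + g ^ 2 * ‖b‖ ^ 2 = g * g * (‖a‖ ^ 2 + ‖b‖ ^ 2) := by ring
      _ ≤ L * g * (‖a‖ ^ 2 + ‖b‖ ^ 2) := by gcongr
      _ = L * g * (inner ℝ (Gx X) a + Gy X * b) +
          L * g * (inner ℝ (a - Gx X) a + (b - Gy X) * b) := by rw [e1, e2]; ring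
      _ ≤ L * g * (inner ℝ (Gx X) a + Gy X * b) +
          L * L * (‖a - Gx X‖ * ‖a‖ + ‖b - Gy X‖ * ‖b‖) := by
          refine add_le_add le_rfl ?_
          calc _ ≤ L * g * (‖a - Gx X‖ * ‖a‖ + ‖b - Gy X‖ * ‖b‖) := by gcongr
            _ ≤ _ := by gcongr
      _ = _ := by ring
  have hI3 : Integrable (fun X => ‖deriv G (φ X) • gradX φ X‖ ^ 2 +
      ‖deriv G (φ X) * derivY φ X‖ ^ 2) μ := by
    refine Integrable.mono' ((hI1.const_mul (L : ℝ)).add hI2) (by fun_prop)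
      (ae_of_all _ fun X => ?_)
    rw [Real.norm_of_nonneg (by positivity)]
    exact hpt X
  have hE : energy α D (fun X => G (φ X)) = ENNReal.ofReal
      (∫ X, (‖deriv G (φ X) • gradX φ X‖ ^ 2 + ‖deriv G (φ X) * derivY φ X‖ ^ 2) ∂μ) := by
    rw [ofReal_integral_eq_lintegral_ofReal hI3 (ae_of_all _ fun X => by positivity), energy]
    refine lintegral_congr fun X => ?_
    rw [hgx, hgy, ENNReal.ofReal_add (by positivity) (by positivity),
      ENNReal.ofReal_pow (norm_nonneg _), ENNReal.ofReal_pow (norm_nonneg _),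
      ofReal_norm, ofReal_norm]
  have hcs : ENNReal.ofReal (∫ X, L ^ 2 * (‖gradX φ X - Gx X‖ * ‖gradX φ X‖ +
      ‖derivY φ X - Gy X‖ * ‖derivY φ X‖) ∂μ) ≤
      L ^ 2 * (eLpNorm (fun X => gradX φ X - Gx X) 2 μ * eLpNorm (gradX φ) 2 μ +
        eLpNorm (fun X => derivY φ X - Gy X) 2 μ * eLpNorm (derivY φ) 2 μ) := by
    rw [integral_const_mul, ENNReal.ofReal_mul (by positivity), integral_add hJx hJy,
      ENNReal.ofReal_pow hLn, ENNReal.ofReal_coe_nnreal]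
    refine mul_le_mul' le_rfl (ENNReal.ofReal_add_le.trans (add_le_add ?_ ?_))
    · rw [ofReal_integral_eq_lintegral_ofReal hJx (ae_of_all _ fun X => by positivity)]
      simp_rw [ENNReal.ofReal_mul (norm_nonneg _), ofReal_norm]
      exact lintegral_enorm_mul_enorm_le (hx.sub hGx).1 hx.1
    · rw [ofReal_integral_eq_lintegral_ofReal hJy (ae_of_all _ fun X => by positivity)]
      simp_rw [ENNReal.ofReal_mul (norm_nonneg _), ofReal_norm]
      exact lintegral_enorm_mul_enorm_le (hy.sub hGy).1 hy.1
  rw [hE, ← hw]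
  refine le_trans (ENNReal.ofReal_le_ofReal (integral_mono hI3
    ((hI1.const_mul (L : ℝ)).add hI2) hpt)) ?_
  simp only [Pi.add_apply]
  rw [integral_add (hI1.const_mul (L : ℝ)) hI2, integral_const_mul]
  exact ENNReal.ofReal_add_le.trans (add_le_add le_rfl hcs)

/-- Level-set estimate for the trace `u` of a solution. Tested against the truncation at height
`s`, the equation bounds the energy of the truncated solution by `s ∫_{|u| > s} |f|`, and the trace
inequality on the set `{|u| > 2s}`, where the truncation equals `±s`, turns this into a bound of
its measure. -/
theorem exists_level_estimate {α : ℝ} (hα : 0 < α) (hN : 2 * α < N) :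
    ∃ c : ℝ≥0, ∀ (D : Set (𝔼 N)), MeasurableSet D → volume D ≠ ⊤ → ∀ (f : (𝔼 N) → ℝ),
      IntegrableOn f D → ∀ (Gx : (𝔼 N) × ℝ → 𝔼 N) (Gy : (𝔼 N) × ℝ → ℝ),
      MemLp Gx 2 (weightedMeasure α D) → MemLp Gy 2 (weightedMeasure α D) →
      (∀ φ, IsTestFunction (D ×ˢ (univ : Set ℝ)) φ →
        ∫ X, (inner ℝ (Gx X) (gradX φ X) + Gy X * derivY φ X) ∂(weightedMeasure α D)
          = ∫ x in D, f x * φ (x, 0)) →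
      ∀ (φ : ℕ → (𝔼 N) × ℝ → ℝ), (∀ n, IsTestFunction (D ×ˢ (univ : Set ℝ)) (φ n)) →
      Tendsto (fun n => eLpNorm (fun X => gradX (φ n) X - Gx X) 2 (weightedMeasure α D))
        atTop (𝓝 0) →
      Tendsto (fun n => eLpNorm (fun X => derivY (φ n) X - Gy X) 2 (weightedMeasure α D))
        atTop (𝓝 0) →
      ∀ u : (𝔼 N) → ℝ, AEStronglyMeasurable u (volume.restrict D) →
      (∀ᵐ x ∂volume.restrict D, Tendsto (fun n => φ n (x, 0)) atTop (𝓝 (u x))) →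
      ∀ s : ℝ, 0 < s →
        ENNReal.ofReal s * volume.restrict D {x | 2 * s < |u x|} ^ (1 - 2 * α / N)
          ≤ c * ∫⁻ x in {x | s < |u x|}, ‖f x‖ₑ ∂volume.restrict D := by
  obtain ⟨C, hC⟩ := exists_lintegral_trace_le (N := N) hα hN
  obtain ⟨L, hL⟩ := exists_isTruncation
  refine ⟨C ^ 2 * L, fun D hD hDt f hf Gx Gy hGx hGy hweak φ hφ hφx hφy u hu hlim s hs => ?_⟩
  obtain ⟨G, hG⟩ := hL s hs
  set μ := weightedMeasure α D with hμ
  have hN0 : (0 : ℝ) < N := by linarith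
  have hGc : Continuous G := hG.smooth.continuous
  have hφc (n : ℕ) : Continuous (φ n) := (hφ n).continuous
  have : IsFiniteMeasure (volume.restrict D) := ⟨by simpa using hDt.lt_top⟩
  -- a measurable copy of the superlevel set, inside `D`
  obtain ⟨A, hAsub, hA, hAae⟩ : ∃ A ⊆ D ∩ {x | 2 * s < |u x|}, MeasurableSet A ∧
      volume A = volume.restrict D {x | 2 * s < |u x|} := by
    have hnull : NullMeasurableSet {x | 2 * s < |u x|} (volume.restrict D) :=
      nullMeasurableSet_lt aemeasurable_const (by
        simpa only [← Real.norm_eq_abs] using hu.norm.aemeasurable)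
    obtain ⟨B, hB, hBm, hBae⟩ := hnull.exists_measurable_subset_ae_eq
    refine ⟨D ∩ B, inter_subset_inter_right _ hB, hD.inter hBm, ?_⟩
    rw [← measure_congr hBae, Measure.restrict_apply hBm, inter_comm]
  rw [← hAae]
  have hAD : A ⊆ D := fun x hx => (hAsub hx).1
  have hAt : volume A ≠ ⊤ := measure_ne_top_of_subset hAD hDt
  set F := ∫⁻ x in {x | s < |u x|}, ‖f x‖ₑ ∂volume.restrict D with hF
  set V := volume A with hV
  set S := ENNReal.ofReal s with hS
  have hlim' : ∀ᵐ x ∂volume.restrict D,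
      Tendsto (fun n => G (φ n (x, 0))) atTop (𝓝 (G (u x))) :=
    hlim.mono fun x hx => (hGc.tendsto _).comp hx
  have hGn (t : ℝ) : ‖G t‖ₑ ≤ S := by
    rw [Real.enorm_eq_ofReal_abs]; exact ENNReal.ofReal_le_ofReal (hG.abs_le t)
  -- the boundary integral over `A` passes to the limit
  have hleft : Tendsto (fun n => ∫⁻ x in A, ‖G (φ n (x, 0))‖ₑ) atTop (𝓝 (S * V)) := by
    have h1 : Tendsto (fun n => ∫⁻ x in A, ‖G (φ n (x, 0))‖ₑ) atTop
        (𝓝 (∫⁻ x in A, ‖G (u x)‖ₑ)) := by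
      refine tendsto_lintegral_of_dominated_convergence (fun _ => S)
        (fun n => (show Continuous fun x => G (φ n (x, 0)) by fun_prop).measurable.enorm)
        (fun n => ae_of_all _ fun x => hGn _) ?_ ?_
      · rw [setLIntegral_const]; exact ENNReal.mul_ne_top (by simp [hS]) hAt
      · filter_upwards [ae_mono (Measure.restrict_mono hAD le_rfl) hlim'] with x hx
        exact (continuous_enorm.tendsto _).comp hx
    have h2 : ∫⁻ x in A, ‖G (u x)‖ₑ = S * V := by
      rw [← setLIntegral_const]
      refine setLIntegral_congr_fun hA fun x hx => ?_
      rw [Real.enorm_eq_ofReal_abs, hG.abs_eq _ (hAsub hx).2.le]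
    rwa [h2] at h1
  -- the energies of the truncations are bounded in the limit by the boundary term
  have hint : Tendsto (fun n => ∫ x in D, f x * G (φ n (x, 0))) atTop
      (𝓝 (∫ x in D, f x * G (u x))) := by
    refine tendsto_integral_of_dominated_convergence (fun x => ‖f x‖ * s)
      (fun n => hf.1.mul (by fun_prop)) (hf.norm.mul_const s)
      (fun n => ae_of_all _ fun x => ?_) (hlim'.mono fun x hx => hx.const_mul _)
    rw [norm_mul]
    gcongr
    exact hG.abs_le _
  have hFle : ENNReal.ofReal (L * ∫ x in D, f x * G (u x)) ≤ L * (S * F) := by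
    rw [ENNReal.ofReal_mul L.coe_nonneg, ENNReal.ofReal_coe_nnreal]
    refine mul_le_mul' le_rfl ?_
    calc ENNReal.ofReal (∫ x in D, f x * G (u x)) ≤ ‖∫ x in D, f x * G (u x)‖ₑ := by
          rw [Real.enorm_eq_ofReal_abs]; exact ENNReal.ofReal_le_ofReal (le_abs_self _)
      _ ≤ ∫⁻ x in D, ‖f x * G (u x)‖ₑ := enorm_integral_le_lintegral_enorm _
      _ ≤ ∫⁻ x in D, {x | s < |u x|}.indicator (fun x => S * ‖f x‖ₑ) x := by
          refine lintegral_mono fun x => ?_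
          by_cases hx : s < |u x|
          · rw [indicator_of_mem (by exact hx), enorm_mul, mul_comm]
            exact mul_le_mul' (hGn _) le_rfl
          · rw [hG.eq_zero _ (not_lt.1 hx)]; simp
      _ ≤ ∫⁻ x in {x | s < |u x|}, S * ‖f x‖ₑ ∂volume.restrict D := lintegral_indicator_le _ _
      _ = S * F := lintegral_const_mul' _ _ (by simp [hS])
  have hbx (n : ℕ) : eLpNorm (gradX (φ n)) 2 μ
      ≤ eLpNorm (fun X => gradX (φ n) X - Gx X) 2 μ + eLpNorm Gx 2 μ := by
    have := eLpNorm_add_le (f := fun X => gradX (φ n) X - Gx X) (g := Gx) (p := 2) (μ := μ)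
      ((hφ n).continuous_gradX.aestronglyMeasurable.sub hGx.1) hGx.1 (by norm_num)
    rwa [show (fun X => gradX (φ n) X - Gx X) + Gx = gradX (φ n) by ext X; simp] at this
  have hby (n : ℕ) : eLpNorm (derivY (φ n)) 2 μ
      ≤ eLpNorm (fun X => derivY (φ n) X - Gy X) 2 μ + eLpNorm Gy 2 μ := by
    have := eLpNorm_add_le (f := fun X => derivY (φ n) X - Gy X) (g := Gy) (p := 2) (μ := μ)
      ((hφ n).continuous_derivY.aestronglyMeasurable.sub hGy.1) hGy.1 (by norm_num)
    rwa [show (fun X => derivY (φ n) X - Gy X) + Gy = derivY (φ n) by ext X; simp] at this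
  set R : ℕ → ℝ≥0∞ := fun n => ENNReal.ofReal (L * ∫ x in D, f x * G (φ n (x, 0))) +
      L ^ 2 * (eLpNorm (fun X => gradX (φ n) X - Gx X) 2 μ *
          (eLpNorm (fun X => gradX (φ n) X - Gx X) 2 μ + eLpNorm Gx 2 μ) +
        eLpNorm (fun X => derivY (φ n) X - Gy X) 2 μ *
          (eLpNorm (fun X => derivY (φ n) X - Gy X) 2 μ + eLpNorm Gy 2 μ)) with hR
  have hRlim : Tendsto R atTop (𝓝 (ENNReal.ofReal (L * ∫ x in D, f x * G (u x)))) := by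
    have ha := ENNReal.Tendsto.mul hφx (Or.inr (by simpa using hGx.2.ne))
      (hφx.add_const (eLpNorm Gx 2 μ)) (Or.inr (by simp))
    have hb := ENNReal.Tendsto.mul hφy (Or.inr (by simpa using hGy.2.ne))
      (hφy.add_const (eLpNorm Gy 2 μ)) (Or.inr (by simp))
    have hc := (ENNReal.tendsto_ofReal (hint.const_mul (L : ℝ))).add
      (ENNReal.Tendsto.const_mul (a := (L : ℝ≥0∞) ^ 2) (ha.add hb) (Or.inr (by simp)))
    simpa only [zero_mul, add_zero, mul_zero] using hc
  have hev : ∀ᶠ n in atTop, ∫⁻ x in A, ‖G (φ n (x, 0))‖ₑ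
      ≤ C * R n ^ (1 / 2 : ℝ) * V ^ (1 / 2 + α / N) := by
    filter_upwards [hφx.eventually_lt_const ENNReal.zero_lt_top,
      hφy.eventually_lt_const ENNReal.zero_lt_top] with n hnx hny
    have hmx : MemLp (gradX (φ n)) 2 μ := ⟨(hφ n).continuous_gradX.aestronglyMeasurable,
      (hbx n).trans_lt (ENNReal.add_lt_top.2 ⟨hnx, hGx.2⟩)⟩
    have hmy : MemLp (derivY (φ n)) 2 μ := ⟨(hφ n).continuous_derivY.aestronglyMeasurable,
      (hby n).trans_lt (ENNReal.add_lt_top.2 ⟨hny, hGy.2⟩)⟩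
    have hG0 : G 0 = 0 := hG.eq_zero 0 (by simpa using hs.le)
    refine (hC D _ hD ((hφ n).comp hG.smooth hG0) A hA hAt).trans ?_
    gcongr
    refine (energy_truncation_le hGx hGy hweak hs hG (hφ n) hmx hmy).trans ?_
    exact add_le_add le_rfl (mul_le_mul' le_rfl (add_le_add (mul_le_mul' le_rfl (hbx n))
      (mul_le_mul' le_rfl (hby n))))
  have hVp : V ^ (1 / 2 + α / N) ≠ ⊤ := ENNReal.rpow_ne_top_of_nonneg (by positivity) hAt
  have hfin : S * V ≤ C * (L * (S * F)) ^ (1 / 2 : ℝ) * V ^ (1 / 2 + α / N) := by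
    have h1 := le_of_tendsto_of_tendsto hleft (ENNReal.Tendsto.mul_const
      (ENNReal.Tendsto.const_mul ((ENNReal.continuous_rpow_const.tendsto _).comp hRlim)
        (Or.inr (by simp))) (Or.inr hVp)) hev
    refine h1.trans ?_
    gcongr
  -- squaring, and dividing by `s |A| ^ (1 + 2α / N)`
  rcases eq_or_ne V 0 with hV0 | hV0
  · have : 0 < 1 - 2 * α / N := by rw [sub_pos, div_lt_one hN0]; exact hN
    rw [hV0, ENNReal.zero_rpow_of_pos this, mul_zero]; exact zero_le
  have hS0 : S ≠ 0 := by simpa [hS] using hs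
  have hsq := pow_le_pow_left' hfin 2
  have e1 : (S * V) ^ 2 = (S * V ^ (1 + 2 * α / N)) * (S * V ^ (1 - 2 * α / N)) := by
    rw [mul_mul_mul_comm, ← ENNReal.rpow_add _ _ hV0 hAt,
      show (1 + 2 * α / N) + (1 - 2 * α / N) = (2 : ℕ) by push_cast; ring,
      ENNReal.rpow_natCast]
    ring
  have e2 : (V ^ (1 / 2 + α / N)) ^ 2 = V ^ (1 + 2 * α / N) := by
    rw [← ENNReal.rpow_natCast, ← ENNReal.rpow_mul]
    congr 1; push_cast; ring
  rw [e1, mul_pow, mul_pow, rpow_half_sq, e2] at hsq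
  refine (ENNReal.mul_le_mul_iff_right (a := S * V ^ (1 + 2 * α / N)) ?_ ?_).1
    (hsq.trans (le_of_eq ?_))
  · exact mul_ne_zero hS0 (by simp [hV0, hAt])
  · exact ENNReal.mul_ne_top (by simp [hS]) (ENNReal.rpow_ne_top_of_nonneg (by positivity) hAt)
  · push_cast; ring

/-! ### The estimate for solutions -/

/-- A Hölder continuous function on a bounded open set is bounded. -/
theorem integrableOn_of_holderOnWith {N : ℕ} {D : Set (EuclideanSpace ℝ (Fin N))} (hD : IsOpen D)
    (hne : D.Nonempty) (hb : Bornology.IsBounded D) {β K : ℝ≥0} {f : EuclideanSpace ℝ (Fin N) → ℝ}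
    (hβ : 0 < β) (hf : HolderOnWith K β f D) : IntegrableOn f D := by
  obtain ⟨x₀, hx₀⟩ := hne
  have : IsFiniteMeasure (volume.restrict D) := ⟨by simpa using hb.measure_lt_top⟩
  refine Integrable.of_bound (((hf.continuousOn hβ).aestronglyMeasurable hD.measurableSet))
    (|f x₀| + K * Metric.diam D ^ (β : ℝ)) ((ae_restrict_mem hD.measurableSet).mono fun x hx => ?_)
  have h1 : dist (f x) (f x₀) ≤ K * Metric.diam D ^ (β : ℝ) :=
    (hf.dist_le hx hx₀).trans (by gcongr; exact Metric.dist_le_diam_of_mem hb hx hx₀)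
  have h2 := norm_le_norm_add_norm_sub' (f x) (f x₀)
  rw [← dist_eq_norm] at h2
  exact h2.trans (add_le_add le_rfl h1)

end ExtensionProblem

end

theorem propositionA1 (N : ℕ) (α p : ℝ) (hα0 : 0 < α) (hα1 : α < 1)
    (hp1 : 1 < p) (hp2 : p < (N : ℝ) / (2 * α)) :
    ∃ C : ℝ, 0 < C ∧
      ∀ D : Set (EuclideanSpace ℝ (Fin N)),
        IsOpen D → IsConnected D → Bornology.IsBounded D →
      ∀ (β K : ℝ≥0) (f : EuclideanSpace ℝ (Fin N) → ℝ),
        0 < β → β < 1 → HolderOnWith K β f D → (∀ x ∈ D, 0 ≤ f x) →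
      ∀ w : EuclideanSpace ℝ (Fin N) × ℝ → ℝ,
        ExtensionProblem.IsWeakSolution α D f w →
        (∃ u : EuclideanSpace ℝ (Fin N) → ℝ, ExtensionProblem.HasTrace D w u) ∧
        ∀ u : EuclideanSpace ℝ (Fin N) → ℝ, ExtensionProblem.HasTrace D w u →
          eLpNorm u (ENNReal.ofReal ((N : ℝ) * p / ((N : ℝ) - 2 * α * p)))
              (volume.restrict D)
            ≤ ENNReal.ofReal C * eLpNorm f (ENNReal.ofReal p) (volume.restrict D) := by
  have hNp : 2 * α * p < N := by
    rw [lt_div_iff₀ (by positivity)] at hp2; linarith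
  have hN : 2 * α < N := lt_of_le_of_lt (le_mul_of_one_le_right (by positivity) hp1.le) hNp
  have hN0 : (0 : ℝ) < N := by linarith
  have hd1 : 0 < N - 2 * α := by linarith
  have hd2 : 0 < N - 2 * α * p := by linarith
  set κ : ℝ := N / (N - 2 * α) with hκ
  set m : ℝ := N * (p - 1) / (N - 2 * α * p) with hm
  have hκ1 : 1 ≤ κ := by rw [hκ, le_div_iff₀ hd1]; linarith
  have hm0 : 0 < m := div_pos (mul_pos hN0 (by linarith)) hd2
  have hp1' : 0 < p - 1 := by linarith
  have hm1 : m + 1 = p * (N - 2 * α) / (N - 2 * α * p) := by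
    rw [hm, div_add_one hd2.ne']; congr 1; ring
  have hq : (N : ℝ) * p / (N - 2 * α * p) = κ * (m + 1) := by
    rw [hm1, hκ]; field_simp
  have hconj : p.HolderConjugate (κ * (m + 1) / m) := by
    have : κ * (m + 1) / m = p / (p - 1) := by
      rw [← hq, hm, div_div_div_cancel_right₀ hd2.ne', mul_div_mul_left _ _ hN0.ne']
    rw [this]
    exact Real.HolderConjugate.conjExponent hp1
  have hexp : 1 / κ = 1 - 2 * α / N := by rw [hκ]; field_simp
  obtain ⟨c, hc⟩ := ExtensionProblem.exists_level_estimate (N := N) hα0 hN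
  rw [← hexp] at hc
  -- one is added so that the constant is positive
  set C₀ : ℝ := (2 ^ (κ * (m + 1)) * (κ * (m + 1)) * c ^ κ / m) ^ (1 / κ) with hC₀
  have hC₀0 : 0 ≤ C₀ := by positivity
  refine ⟨C₀ + 1, by positivity, fun D hD hconn hb β K f hβ _ hf _ w hw => ?_⟩
  obtain ⟨Gx, Gy, hE, hweak⟩ := hw
  obtain ⟨φ, hφ, hφw, hφx, hφy⟩ := hE.lateral_zero
  obtain ⟨v, hv, hφv⟩ := ExtensionProblem.exists_hasTrace hα0 hE.memLp hE.memLp_derivY hφ hφw hφy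
  refine ⟨⟨v, hv⟩, fun u hu => ?_⟩
  have : IsFiniteMeasure (volume.restrict D) := ⟨by simpa using hb.measure_lt_top⟩
  have hfi := ExtensionProblem.integrableOn_of_holderOnWith hD hconn.nonempty hb hβ hf
  have hφ0 (n : ℕ) : Continuous fun x => φ n (x, 0) := by
    have := (hφ n).continuous; fun_prop
  obtain ⟨ns, hns, hae⟩ := (tendstoInMeasure_of_tendsto_eLpNorm two_ne_zero
    (fun n => (hφ0 n).aestronglyMeasurable) hv.memLp.1 hφv).exists_seq_tendsto_ae
  have hlevel := hc D hD.measurableSet hb.measure_lt_top.ne f hfi Gx Gy hE.memLp_gradX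
    hE.memLp_derivY hweak (fun n => φ (ns n)) (fun n => hφ _) (hφx.comp hns.tendsto_atTop)
    (hφy.comp hns.tendsto_atTop) v hv.memLp.1 hae
  rw [eLpNorm_congr_ae (hu.ae_eq hE.memLp.1 hv), hq]
  refine (ExtensionProblem.eLpNorm_le_of_level_estimate hκ1 hm0 hconj hv.memLp.1 hfi.1
    hlevel).trans ?_
  refine mul_le_mul' ?_ le_rfl
  rw [ENNReal.ofReal_rpow_of_nonneg (by positivity) (by positivity)]
  exact ENNReal.ofReal_le_ofReal (by linarith)
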